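/- **Setting.** Given distinct points $z_1,\dots,z_N$ in the open upper half plane and nonzero complex numbers $c_1,\dots,c_N$ (the norming constants), the $N$-soliton solution $\psi_N(x,t)$ of the focusing nonlinear Schrödinger equation $i\psi_t+\frac12\psi_{xx}+|\psi|^2\psi=0$ with reflectionless scattering data $\{(z_k,c_k)\}_{k=1}^N$ is $$\psi_N(x,t)=\lim_{\zeta\to\infty}2i\zeta\,[M(\zeta;x,t)]_{12},$$ where $M(\cdot\,;x,t)$ is the solution of the following Riemann–Hilbert problem: $M$ is $SL(2,\mathbb C)$-valued and analytic in $\mathbb C\setminus\{z_k,\overline z_k\}_{k=1}^N$; $M(\zeta)=I+O(\zeta^{-1})$ as $\zeta\to\infty$; and, with $\theta(\zeta;x,t)=t\zeta^2+x\zeta$, $M$ has simple poles at $z_k$ and $\overline z_k$ with $$\operatorname*{Res}_{\zeta=z_k}M=c_ke^{2i\theta(z_k;x,t)}\lim_{\zeta\to z_k}M(\zeta)\begin{pmatrix}0&0\\1&0\end{pmatrix},\qquad \operatorname*{Res}_{\zeta=\overline z_k}M=-\overline{c_k}\,e^{-2i\theta(\overline z_k;x,t)}\lim_{\zeta\to\overline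 z_k}M(\zeta)\begin{pmatrix}0&1\\0&0\end{pmatrix}.$$ **Assumptions.** Let $\beta>0$, $\gamma>\frac12$ and $\Delta=\Delta_N=\beta N^\gamma$. Let $\mathcal D$ be a probability distribution on $\mathbb R$ with $\mathcal D((0,\infty))=1$ and mean $\mu_{\mathcal D}$ which is sub-exponential with some parameters $\nu,\alpha\ge0$: for $Y\sim\mathcal D$, $\mathbb E\,e^{\lambda(Y-\mu_{\mathcal D})}\le e^{\nu^2\lambda^2/2}$ for all real $\lambda$ with $\alpha|\lambda|<1$. For every $N$ let $\mu_1,\dots,\mu_N$ be i.i.d. random variables with law $\mathcal D$, defined for all $N$ on one common probability space (the sample may depend on $N$, and nothing is assumed about the joint law for different $N$). Let $\psi_N$ be the random $N$-soliton solution with scattering data $$z_k=\tfrac12(-k\Delta+i\mu_k),\qquad c_k=i\mu_ke^{-2iz_k^2},\qquad k=1,\dots,N.$$ **Proposition.** For each fixed $(X,T)\in\mathbb R^2$, $$\frac1{\mu_{\mathcal D}N}\,\psi_N\!\left(\frac{2X}{\Delta N},\,1+\frac{T}{\Delta^2N^2}\right)\longrightarrow\psi_0(X,T):=-\int_0^1e^{i\left(2Xs-\frac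 T2s^2\right)}\,ds\qquad\text{in probability as }N\to\infty.$$ In particular, at $T=0$, for each fixed $X\in\mathbb R$, $$\frac1{\mu_{\mathcal D}N}\,\psi_N\!\left(\frac{2X}{\Delta N},\,1\right)\longrightarrow-e^{iX}\,\frac{\sin X}{X}\qquad\text{in probability as }N\to\infty,$$ where $\frac{\sin X}{X}$ is read as $1$ at $X=0$. -/

import Mathlib

open MeasureTheory ProbabilityTheory Filter Topology Complex

namespace FNLS

noncomputable section

/-- The phase `θ(w; x, t) = x w + t w²`. -/
def theta (w : ℂ) (x t : ℝ) : ℂ := x * w + t * w ^ 2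

/-- The set `{z_k, conj z_k}` of poles. -/
def poles {N : ℕ} (z : Fin N → ℂ) : Set ℂ :=
  {w | ∃ k, w = z k ∨ w = (starRingEnd ℂ) (z k)}

/-- `A` is the limit of `M * E` at `w`, and `(ζ - w) M(ζ) → g A` at `w`: that is, `M` has a pole of
order at most one at `w` and `Res_{ζ = w} M(ζ) = g lim_{ζ → w} M(ζ) E`. -/
def ResidueRelation (M : ℂ → Matrix (Fin 2) (Fin 2) ℂ) (w g : ℂ) (E : Matrix (Fin 2) (Fin 2) ℂ) :
    Prop :=
  ∃ A : Matrix (Fin 2) (Fin 2) ℂ,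
    Tendsto (fun ζ => M ζ * E) (𝓝[≠] w) (𝓝 A) ∧
    Tendsto (fun ζ => (ζ - w) • M ζ) (𝓝[≠] w) (𝓝 (g • A))

/-- `M` solves, at the point `(x, t)`, the Riemann-Hilbert problem of the focusing nonlinear
Schrödinger equation `i ψ_t + ψ_xx / 2 + |ψ|² ψ = 0` with reflectionless scattering data
`(z_k, c_k)`, `k = 1, …, N`. The values of `M` at the poles themselves are irrelevant. -/
structure IsRHPSolution {N : ℕ} (z c : Fin N → ℂ) (x t : ℝ)
    (M : ℂ → Matrix (Fin 2) (Fin 2) ℂ) : Prop where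
  /-- `M` is `SL(2, ℂ)`-valued. -/
  det_eq_one : ∀ ζ ∉ poles z, (M ζ).det = 1
  /-- `M` is analytic off the poles. -/
  analytic : ∀ i j, DifferentiableOn ℂ (fun ζ => M ζ i j) (poles z)ᶜ
  /-- `M = I + O(1/ζ)` as `ζ → ∞`. -/
  normalized : ∀ i j, (fun ζ => M ζ i j - (1 : Matrix (Fin 2) (Fin 2) ℂ) i j)
    =O[Bornology.cobounded ℂ] (fun ζ => ζ⁻¹)
  /-- The residue relation at `z_k`. -/
  residue_upper : ∀ k, ResidueRelation M (z k)
    (c k * exp (2 * I * theta (z k) x t)) !![0, 0; 1, 0]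
  /-- The residue relation at `conj z_k`. -/
  residue_lower : ∀ k, ResidueRelation M ((starRingEnd ℂ) (z k))
    (-((starRingEnd ℂ) (c k) * exp (-2 * I * theta ((starRingEnd ℂ) (z k)) x t))) !![0, 1; 0, 0]

/-- `w = lim_{ζ → ∞} 2 i ζ M(ζ)₁₂` for a solution `M` of the Riemann-Hilbert problem at `(x, t)`. -/
def IsNSolitonValue {N : ℕ} (z c : Fin N → ℂ) (x t : ℝ) (w : ℂ) : Prop :=
  ∃ M : ℂ → Matrix (Fin 2) (Fin 2) ℂ, IsRHPSolution z c x t M ∧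
    Tendsto (fun ζ => 2 * I * ζ * M ζ 0 1) (Bornology.cobounded ℂ) (𝓝 w)

/-- The `N`-soliton solution `ψ_N(x, t)` with reflectionless scattering data `(z_k, c_k)`: the value
recovered from the solution of the Riemann-Hilbert problem. (For distinct `z_k` in the upper half
plane and nonzero `c_k` that problem has a solution, and it is unique off the poles.) -/
def nSoliton {N : ℕ} (z c : Fin N → ℂ) (x t : ℝ) : ℂ :=
  Classical.epsilon (IsNSolitonValue z c x t)

/-- The pole `z_k = (-v_k + i μ_k) / 2` with velocity `v_k = k Δ`. The index `k = 1, …, N` of the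
solitons is `k + 1` for `k : Fin N`. -/
def pole (Δ : ℝ) {N : ℕ} (a : Fin N → ℝ) (k : Fin N) : ℂ :=
  (-(((k : ℕ) + 1 : ℝ) * Δ : ℝ) + I * (a k : ℂ)) / 2

/-- The norming constant `c_k = i μ_k exp (-2 i z_k²)`. -/
def norming (Δ : ℝ) {N : ℕ} (a : Fin N → ℝ) (k : Fin N) : ℂ :=
  I * (a k : ℂ) * exp (-2 * I * pole Δ a k ^ 2)

/-- The `N`-soliton solution with amplitudes `a_1, …, a_N`, velocities `v_k = k Δ`, synchronized so
that the solitons collide at `(x, t) = (0, 1)`. -/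
def syncSoliton (Δ : ℝ) {N : ℕ} (a : Fin N → ℝ) (x t : ℝ) : ℂ :=
  nSoliton (pole Δ a) (norming Δ a) x t

/-- The spacing `Δ = β N^γ` of the velocities. -/
def spacing (β γ : ℝ) (N : ℕ) : ℝ := β * (N : ℝ) ^ γ

/-- The profile `ψ_0(X, T) = - ∫_0^1 exp (i (2 X s - T s² / 2)) ds`. -/
def fresnel (X T : ℝ) : ℂ :=
  -∫ s in (0 : ℝ)..1, exp (I * ((2 * X * s - T / 2 * s ^ 2 : ℝ) : ℂ))

/-- The distribution `D` is sub-exponential with parameters `(ν, α)`: it has a mean `m` and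
`E exp (l (Y - m)) ≤ exp (ν² l² / 2)` for all `|l| < 1 / α` (for all `l` if `α = 0`). -/
structure IsSubExponential (D : Measure ℝ) (ν α : ℝ) : Prop where
  nu_nonneg : 0 ≤ ν
  alpha_nonneg : 0 ≤ α
  integrable_id : Integrable (fun y => y) D
  integrable_exp : ∀ l : ℝ, α * |l| < 1 → Integrable (fun y => Real.exp (l * (y - ∫ u, u ∂D))) D
  mgf_le : ∀ l : ℝ, α * |l| < 1 →
    ∫ y, Real.exp (l * (y - ∫ u, u ∂D)) ∂D ≤ Real.exp (ν ^ 2 * l ^ 2 / 2)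

end

end FNLS

namespace FNLS

/-! By Liouville, the first row of a Riemann-Hilbert solution is a partial fraction expansion.
Evaluating `M₁₁` at `conj z_j` and `M₁₂` at `z_j` gives a finite linear system for `p_j`, `q_j`, and
`ψ_N = -2i ∑ conj(g_k) p_k` (`IsRHPSolution.exists_residueSystem`, and conversely
`IsResidueSystem.isRHPSolution`).

At the collision time the norming constants cancel the quadratic phase, so `g_k = i μ_k e_k` with
`|e_k|` close to 1. Since `conj z_j - z_j = -i μ_j`, the diagonal coefficients are `-e_j`, of order
one, while the off-diagonal ones are `O(max μ / (Δ |j - k|))`, with row sums at most `ε = 8 B (1 +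
log N) / Δ` when all `μ_k ≤ B`. For small `ε` the system nearly decouples into `p + e q = 1`, `q =
conj(e) p`, so `p = 1 / (1 + |e|²) ≈ 1/2`. Hence `ψ_N ≈ -∑ μ_k wave(k / N)`, with error `O(ε ∑ μ_k)`
for fixed `X, T` (`residueSystem_bound`, `norm_syncSoliton_add_le`).

Sub-exponentiality supplies a second moment. A union bound then gives `max μ_k ≤ N ^ b` with
probability tending to 1 for any `b > 1/2`; choosing `b < γ` makes `ε → 0`. Chebyshev replaces `μ_k`
by its mean in the weighted sum, and what remains is a Riemann sum for `fresnel`. All estimates are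
made for one `N` at a time, so the joint law across different `N` plays no role. -/

/-! ### Liouville's theorem with removable singularities. -/

/-- A function holomorphic off a finite set, with at most removable singularities there and
vanishing at infinity, is zero. -/
theorem eq_zero_of_removable_of_tendsto_zero (S : Finset ℂ) :
    ∀ f : ℂ → ℂ, DifferentiableOn ℂ f (S : Set ℂ)ᶜ →
      (∀ w ∈ S, Tendsto (fun ζ => (ζ - w) * f ζ) (𝓝[≠] w) (𝓝 0)) →
      Tendsto f (Bornology.cobounded ℂ) (𝓝 0) → ∀ ζ ∉ S, f ζ = 0 := by
  classical
  induction S using Finset.induction_on with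
  | empty =>
    intro f hf _ hlim ζ _
    have hd : Differentiable ℂ f := by simpa [differentiableOn_univ] using hf
    rw [Metric.cobounded_eq_cocompact] at hlim
    exact hd.apply_eq_of_tendsto_cocompact ζ hlim
  | insert a S ha ih =>
    intro f hf hrem hlim ζ hζ
    set g := Function.update f a (limUnder (𝓝[≠] a) f) with hg
    have hnhds : (S : Set ℂ)ᶜ ∈ 𝓝 a :=
      S.finite_toSet.isClosed.isOpen_compl.mem_nhds (by simpa using ha)
    have hgf : ∀ w, w ≠ a → g w = f w := fun w hw => Function.update_of_ne hw _ _
    -- The value `f a` is arbitrary; subtracting a constant does not affect the Riemann criterion.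
    have ho : (fun z => f z - f a) =o[𝓝[≠] a] fun z => (z - a)⁻¹ := by
      rw [Asymptotics.isLittleO_iff_tendsto']
      · have h1 := hrem a (Finset.mem_insert_self _ _)
        have h2 : Tendsto (fun ζ : ℂ => (ζ - a) * f a) (𝓝[≠] a) (𝓝 0) := by
          have : Tendsto (fun ζ : ℂ => (ζ - a) * f a) (𝓝 a) (𝓝 ((a - a) * f a)) :=
            (Continuous.tendsto (by fun_prop) a)
          simpa using this.mono_left nhdsWithin_le_nhds
        refine (by simpa using h1.sub h2 : Tendsto _ _ (𝓝 (0 : ℂ))).congr fun z => ?_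
        rw [div_inv_eq_mul]; ring
      · filter_upwards [self_mem_nhdsWithin] with z hz h
        exact absurd (sub_eq_zero.1 (inv_eq_zero.1 h)) hz
    have hgd : DifferentiableOn ℂ g (S : Set ℂ)ᶜ := by
      refine differentiableOn_update_limUnder_of_isLittleO hnhds (hf.mono ?_) ho
      intro z hz
      simp only [Finset.coe_insert, Set.mem_compl_iff, Set.mem_insert_iff, not_or]
      exact ⟨hz.2, hz.1⟩
    have hζa : ζ ≠ a := fun h => hζ (h ▸ Finset.mem_insert_self _ _)
    rw [← hgf ζ hζa]
    refine ih g hgd (fun w hw => ?_) ?_ ζ fun h => hζ (Finset.mem_insert_of_mem h)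
    · have hwa : w ≠ a := fun h => ha (h ▸ hw)
      refine (hrem w (Finset.mem_insert_of_mem hw)).congr' ?_
      filter_upwards [mem_nhdsWithin_of_mem_nhds (isOpen_ne.mem_nhds hwa)] with z hz
      rw [hgf z hz]
    · refine hlim.congr' ?_
      filter_upwards [Bornology.eventually_ne_cobounded a] with z hz
      rw [hgf z hz]

/-! ### Local and asymptotic behaviour of sums of simple fractions. -/

/-- The sum `∑ k, b k / (ζ - w k)` of simple fractions. -/
noncomputable def cauchySum {N : ℕ} (w b : Fin N → ℂ) (ζ : ℂ) : ℂ := ∑ k, b k / (ζ - w k)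

section CauchySum

variable {N : ℕ} (w b : Fin N → ℂ)

theorem differentiableAt_cauchySum {ζ : ℂ} (h : ∀ k, ζ ≠ w k) :
    DifferentiableAt ℂ (cauchySum w b) ζ := by
  unfold cauchySum
  refine DifferentiableAt.fun_sum fun k _ => ?_
  exact (differentiableAt_const _).div (by fun_prop) (sub_ne_zero.2 (h k))

theorem tendsto_cauchySum {ζ : ℂ} (h : ∀ k, ζ ≠ w k) :
    Tendsto (cauchySum w b) (𝓝[≠] ζ) (𝓝 (cauchySum w b ζ)) :=
  (differentiableAt_cauchySum w b h).continuousAt.tendsto.mono_left nhdsWithin_le_nhds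

theorem tendsto_sub_self (a : ℂ) : Tendsto (fun ζ : ℂ => ζ - a) (𝓝[≠] a) (𝓝 0) := by
  have : Tendsto (fun ζ : ℂ => ζ - a) (𝓝 a) (𝓝 (a - a)) := Continuous.tendsto (by fun_prop) a
  rw [sub_self] at this
  exact this.mono_left nhdsWithin_le_nhds

theorem tendsto_sub_mul_cauchySum_of_ne {ζ : ℂ} (h : ∀ k, ζ ≠ w k) :
    Tendsto (fun z => (z - ζ) * cauchySum w b z) (𝓝[≠] ζ) (𝓝 0) := by
  simpa using (tendsto_sub_self ζ).mul (tendsto_cauchySum w b h)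

theorem tendsto_sub_mul_cauchySum (hw : Function.Injective w) (j : Fin N) :
    Tendsto (fun z => (z - w j) * cauchySum w b z) (𝓝[≠] (w j)) (𝓝 (b j)) := by
  have h : ∀ k, Tendsto (fun z => (z - w j) * (b k / (z - w k))) (𝓝[≠] (w j))
      (𝓝 (if k = j then b j else 0)) := by
    intro k
    split_ifs with hk
    · subst hk
      refine tendsto_const_nhds.congr' ?_
      filter_upwards [self_mem_nhdsWithin] with z hz
      exact (mul_div_cancel₀ _ (sub_ne_zero.2 hz)).symm
    · have hne : w j ≠ w k := fun h => hk (hw h).symm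
      have : Tendsto (fun z => b k / (z - w k)) (𝓝 (w j)) (𝓝 (b k / (w j - w k))) :=
        tendsto_const_nhds.div (Continuous.tendsto (by fun_prop) _) (sub_ne_zero.2 hne)
      simpa using (tendsto_sub_self (w j)).mul (this.mono_left nhdsWithin_le_nhds)
  have := tendsto_finsetSum Finset.univ fun k _ => h k
  simpa [cauchySum, Finset.mul_sum] using this

theorem tendsto_inv_sub_cobounded (a : ℂ) :
    Tendsto (fun ζ : ℂ => (ζ - a)⁻¹) (Bornology.cobounded ℂ) (𝓝 0) :=
  tendsto_inv₀_cobounded.comp (tendsto_sub_const_cobounded a)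

theorem tendsto_mul_cauchySum_cobounded :
    Tendsto (fun ζ => ζ * cauchySum w b ζ) (Bornology.cobounded ℂ) (𝓝 (∑ k, b k)) := by
  simp only [cauchySum, Finset.mul_sum]
  refine tendsto_finsetSum _ fun k _ => ?_
  have h := ((tendsto_inv_sub_cobounded (w k)).const_mul (w k)).const_add 1 |>.const_mul (b k)
  simp only [mul_zero, add_zero, mul_one] at h
  refine h.congr' ?_
  filter_upwards [Bornology.eventually_ne_cobounded (w k)] with z hz
  have : z - w k ≠ 0 := sub_ne_zero.2 hz
  field_simp
  ring

theorem cauchySum_isBigO :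
    cauchySum w b =O[Bornology.cobounded ℂ] (fun ζ : ℂ => ζ⁻¹) := by
  have h := (Asymptotics.isBigO_refl (fun ζ : ℂ => ζ⁻¹) (Bornology.cobounded ℂ)).mul
    ((tendsto_mul_cauchySum_cobounded w b).isBigO_one ℂ)
  simp only [mul_one] at h
  refine h.congr' ?_ EventuallyEq.rfl
  filter_upwards [Bornology.eventually_ne_cobounded 0] with z hz
  rw [inv_mul_cancel_left₀ hz]

theorem tendsto_cauchySum_cobounded :
    Tendsto (cauchySum w b) (Bornology.cobounded ℂ) (𝓝 0) :=
  (cauchySum_isBigO w b).trans_tendsto tendsto_inv₀_cobounded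

end CauchySum

/-! ### From the Riemann-Hilbert problem to a linear system. -/

/-- The linear system satisfied by the values `p k = M₁₁(conj z_k)` and `q k = M₁₂(z_k)` of the first
row of a solution of the Riemann-Hilbert problem whose residue relations have the constants `g`. -/
structure IsResidueSystem {N : ℕ} (z g p q : Fin N → ℂ) : Prop where
  eq_p : ∀ j, p j = 1 + ∑ k, g k * q k / (starRingEnd ℂ (z j) - z k)
  eq_q : ∀ j, q j = -∑ k, starRingEnd ℂ (g k) * p k / (z j - starRingEnd ℂ (z k))

/-- The constant `c_k exp (2 i θ(z_k))` of the residue relation at `z_k`. -/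
noncomputable def residueConst {N : ℕ} (z c : Fin N → ℂ) (x t : ℝ) (k : Fin N) : ℂ :=
  c k * exp (2 * I * theta (z k) x t)

section

variable {N : ℕ} {z c : Fin N → ℂ} {x t : ℝ}

theorem conj_residueConst (k : Fin N) :
    starRingEnd ℂ (residueConst z c x t k) =
      starRingEnd ℂ (c k) * exp (-2 * I * theta (starRingEnd ℂ (z k)) x t) := by
  simp [residueConst, theta, ← exp_conj, map_ofNat]

theorem conj_pole_ne (hz : ∀ k, 0 < (z k).im) (j k : Fin N) : starRingEnd ℂ (z j) ≠ z k := by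
  intro h
  have := congrArg Complex.im h
  rw [conj_im] at this
  linarith [hz j, hz k]

theorem pole_ne_conj (hz : ∀ k, 0 < (z k).im) (j k : Fin N) : z j ≠ starRingEnd ℂ (z k) :=
  (conj_pole_ne hz k j).symm

theorem conj_comp_injective (hinj : Function.Injective z) :
    Function.Injective fun k => starRingEnd ℂ (z k) :=
  (starRingEnd ℂ).injective.comp hinj

theorem exists_finset_eq_poles (z : Fin N → ℂ) :
    ∃ S : Finset ℂ, (S : Set ℂ) = poles z ∧
      ∀ w, w ∈ S ↔ ∃ k, w = z k ∨ w = starRingEnd ℂ (z k) := by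
  classical
  have h : (poles z).Finite := by
    refine ((Set.finite_range z).union
      (Set.finite_range fun k => starRingEnd ℂ (z k))).subset ?_
    rintro w ⟨k, rfl | rfl⟩
    · exact Or.inl ⟨k, rfl⟩
    · exact Or.inr ⟨k, rfl⟩
  exact ⟨h.toFinset, h.coe_toFinset, fun w => by simp [poles]⟩

theorem eventually_notMem_poles_nhdsNE (z : Fin N → ℂ) (w : ℂ) :
    ∀ᶠ ζ in 𝓝[≠] w, ζ ∉ poles z := by
  obtain ⟨S, hS, -⟩ := exists_finset_eq_poles z
  rw [← hS]
  have h : ((S : Set ℂ) \ {w})ᶜ ∈ 𝓝 w :=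
    (S.finite_toSet.subset Set.sdiff_subset).isClosed.isOpen_compl.mem_nhds (by simp)
  filter_upwards [self_mem_nhdsWithin, mem_nhdsWithin_of_mem_nhds h] with ζ h1 h2 h3
  exact h2 ⟨h3, h1⟩

theorem eventually_notMem_poles_cobounded (z : Fin N → ℂ) :
    ∀ᶠ ζ in Bornology.cobounded ℂ, ζ ∉ poles z := by
  obtain ⟨S, hS, -⟩ := exists_finset_eq_poles z
  rw [← hS]
  exact Bornology.isBounded_def.1 S.finite_toSet.isBounded

theorem tendsto_matrix_entry {l : Filter ℂ} {F : ℂ → Matrix (Fin 2) (Fin 2) ℂ}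
    {A : Matrix (Fin 2) (Fin 2) ℂ} (h : Tendsto F l (𝓝 A)) (i j : Fin 2) :
    Tendsto (fun ζ => F ζ i j) l (𝓝 (A i j)) :=
  tendsto_pi_nhds.1 (tendsto_pi_nhds.1 h i) j

/-- The first row of a solution of the Riemann-Hilbert problem is determined by a solution of the
residue system. -/
theorem IsRHPSolution.exists_residueSystem (hz : ∀ k, 0 < (z k).im)
    (hinj : Function.Injective z) {M : ℂ → Matrix (Fin 2) (Fin 2) ℂ}
    (hM : IsRHPSolution z c x t M) :
    ∃ p q, IsResidueSystem z (residueConst z c x t) p q ∧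
      ∀ ζ ∉ poles z, M ζ 0 1 = -cauchySum (fun k => starRingEnd ℂ (z k))
        (fun k => starRingEnd ℂ (residueConst z c x t k) * p k) ζ := by
  obtain ⟨S, hS, hSmem⟩ := exists_finset_eq_poles z
  choose A hA hA' using hM.residue_upper
  choose B hB hB' using hM.residue_lower
  set g := residueConst z c x t with hg
  set zb : Fin N → ℂ := fun k => starRingEnd ℂ (z k) with hzb
  have hbinj : Function.Injective zb := conj_comp_injective hinj
  -- The nilpotent factor moves the second column into the first, so the mere existence of the limit
  -- `A k` says that the second column has no pole at `z k`. At `zb k` the columns exchange roles.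
  have hq : ∀ k, Tendsto (fun ζ => M ζ 0 1) (𝓝[≠] (z k)) (𝓝 (A k 0 0)) := fun k => by
    simpa [Matrix.mul_apply, Fin.sum_univ_two] using tendsto_matrix_entry (hA k) 0 0
  have hp : ∀ k, Tendsto (fun ζ => M ζ 0 0) (𝓝[≠] (zb k)) (𝓝 (B k 0 1)) := fun k => by
    simpa [Matrix.mul_apply, Fin.sum_univ_two] using tendsto_matrix_entry (hB k) 0 1
  have hpres : ∀ k, Tendsto (fun ζ => (ζ - z k) * M ζ 0 0) (𝓝[≠] (z k)) (𝓝 (g k * A k 0 0)) :=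
    fun k => by simpa [hg, residueConst] using tendsto_matrix_entry (hA' k) 0 0
  have hqres : ∀ k, Tendsto (fun ζ => (ζ - zb k) * M ζ 0 1) (𝓝[≠] (zb k))
      (𝓝 (-(starRingEnd ℂ (g k) * B k 0 1))) := fun k => by
    rw [hg, conj_residueConst, ← neg_mul]
    simpa using tendsto_matrix_entry (hB' k) 0 1
  have key : ∀ (F G : ℂ → ℂ), DifferentiableOn ℂ F (poles z)ᶜ →
      (∀ ζ ∉ poles z, DifferentiableAt ℂ G ζ) →
      (∀ k, Tendsto (fun ζ => (ζ - z k) * (F ζ - G ζ)) (𝓝[≠] (z k)) (𝓝 0)) →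
      (∀ k, Tendsto (fun ζ => (ζ - zb k) * (F ζ - G ζ)) (𝓝[≠] (zb k)) (𝓝 0)) →
      Tendsto (fun ζ => F ζ - G ζ) (Bornology.cobounded ℂ) (𝓝 0) →
      ∀ ζ ∉ poles z, F ζ = G ζ := by
    intro F G hF hG h1 h2 h3 ζ hζ
    refine sub_eq_zero.1 (eq_zero_of_removable_of_tendsto_zero S (fun ζ => F ζ - G ζ) ?_ ?_ h3 ζ ?_)
    · rw [hS]
      exact hF.sub fun w hw => (hG w hw).differentiableWithinAt
    · intro w hw
      obtain ⟨k, rfl | rfl⟩ := (hSmem w).1 hw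
      exacts [h1 k, h2 k]
    · rw [← Finset.mem_coe, hS]; exact hζ
  have hne : ∀ ζ ∉ poles z, (∀ k, ζ ≠ z k) ∧ ∀ k, ζ ≠ zb k := fun ζ hζ =>
    ⟨fun k h => hζ ⟨k, Or.inl h⟩, fun k h => hζ ⟨k, Or.inr h⟩⟩
  have hnorm : ∀ i j, Tendsto (fun ζ => M ζ i j - (1 : Matrix (Fin 2) (Fin 2) ℂ) i j)
      (Bornology.cobounded ℂ) (𝓝 0) := fun i j =>
    (hM.normalized i j).trans_tendsto tendsto_inv₀_cobounded
  have hP : ∀ ζ ∉ poles z, M ζ 0 0 = 1 + cauchySum z (fun k => g k * A k 0 0) ζ := by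
    refine key _ _ (hM.analytic 0 0)
      (fun ζ hζ => (differentiableAt_const _).add (differentiableAt_cauchySum _ _ (hne ζ hζ).1))
      (fun k => ?_) (fun k => ?_) ?_
    · have := ((hpres k).sub (tendsto_sub_self (z k))).sub
        (tendsto_sub_mul_cauchySum z (fun k => g k * A k 0 0) hinj k)
      simp only [sub_zero, sub_self] at this
      exact this.congr fun ζ => by ring
    · have := (((tendsto_sub_self (zb k)).mul (hp k)).sub (tendsto_sub_self (zb k))).sub
        (tendsto_sub_mul_cauchySum_of_ne z (fun k => g k * A k 0 0) (conj_pole_ne hz k))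
      simp only [sub_zero, zero_mul] at this
      exact this.congr fun ζ => by ring
    · have := (hnorm 0 0).sub (tendsto_cauchySum_cobounded z fun k => g k * A k 0 0)
      simp only [sub_zero, Matrix.one_apply_eq] at this
      exact this.congr fun ζ => by ring
  have hQ : ∀ ζ ∉ poles z, M ζ 0 1 = -cauchySum zb (fun k => starRingEnd ℂ (g k) * B k 0 1) ζ := by
    refine key _ _ (hM.analytic 0 1)
      (fun ζ hζ => (differentiableAt_cauchySum _ _ (hne ζ hζ).2).neg)
      (fun k => ?_) (fun k => ?_) ?_
    · have := ((tendsto_sub_self (z k)).mul (hq k)).add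
        (tendsto_sub_mul_cauchySum_of_ne zb (fun k => starRingEnd ℂ (g k) * B k 0 1)
          (pole_ne_conj hz k))
      simp only [add_zero, zero_mul] at this
      exact this.congr fun ζ => by ring
    · have := (hqres k).add
        (tendsto_sub_mul_cauchySum zb (fun k => starRingEnd ℂ (g k) * B k 0 1) hbinj k)
      simp only [neg_add_cancel] at this
      exact this.congr fun ζ => by ring
    · have := (hnorm 0 1).add
        (tendsto_cauchySum_cobounded zb fun k => starRingEnd ℂ (g k) * B k 0 1)
      simp only [add_zero] at this
      exact this.congr fun ζ => by simp
  -- Each expansion has poles in one half plane only; evaluating it at the poles of the other closes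
  -- the system.
  refine ⟨fun k => B k 0 1, fun k => A k 0 0, ⟨fun j => ?_, fun j => ?_⟩, hQ⟩
  · refine tendsto_nhds_unique (hp j) (Tendsto.congr' ?_ (tendsto_const_nhds.add
      (tendsto_cauchySum z (fun k => g k * A k 0 0) (conj_pole_ne hz j))))
    filter_upwards [eventually_notMem_poles_nhdsNE z (zb j)] with ζ hζ using (hP ζ hζ).symm
  · refine tendsto_nhds_unique (hq j) (Tendsto.congr' ?_
      (tendsto_cauchySum zb (fun k => starRingEnd ℂ (g k) * B k 0 1) (pole_ne_conj hz j)).neg)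
    filter_upwards [eventually_notMem_poles_nhdsNE z (z j)] with ζ hζ using (hQ ζ hζ).symm

/-- The limit of `2 i ζ m(ζ)` when `m` is the negative of a sum of simple fractions. -/
theorem tendsto_solitonValue (z b : Fin N → ℂ) {m : ℂ → ℂ}
    (hm : ∀ ζ ∉ poles z, m ζ = -cauchySum (fun k => starRingEnd ℂ (z k)) b ζ) :
    Tendsto (fun ζ => 2 * I * ζ * m ζ) (Bornology.cobounded ℂ) (𝓝 (-2 * I * ∑ k, b k)) := by
  have := (tendsto_mul_cauchySum_cobounded (fun k => starRingEnd ℂ (z k)) b).const_mul (-2 * I)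
  refine this.congr' ?_
  filter_upwards [eventually_notMem_poles_cobounded z] with ζ hζ
  rw [hm ζ hζ]
  ring

theorem IsNSolitonValue.exists_residueSystem (hz : ∀ k, 0 < (z k).im)
    (hinj : Function.Injective z) {w : ℂ} (hw : IsNSolitonValue z c x t w) :
    ∃ p q, IsResidueSystem z (residueConst z c x t) p q ∧
      w = -2 * I * ∑ k, starRingEnd ℂ (residueConst z c x t k) * p k := by
  obtain ⟨M, hM, hlim⟩ := hw
  obtain ⟨p, q, h, hm⟩ := hM.exists_residueSystem hz hinj
  exact ⟨p, q, h, tendsto_nhds_unique hlim (tendsto_solitonValue z _ hm)⟩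

end

/-! ### From the linear system back to the Riemann-Hilbert problem. -/

/-- The matrix built from a solution of the residue system. -/
noncomputable def residueMatrix {N : ℕ} (z g p q : Fin N → ℂ) (ζ : ℂ) : Matrix (Fin 2) (Fin 2) ℂ :=
  !![1 + cauchySum z (fun k => g k * q k) ζ,
      -cauchySum (fun k => starRingEnd ℂ (z k)) (fun k => starRingEnd ℂ (g k) * p k) ζ;
    cauchySum z (fun k => g k * starRingEnd ℂ (p k)) ζ,
      1 + cauchySum (fun k => starRingEnd ℂ (z k)) (fun k => starRingEnd ℂ (g k * q k)) ζ]

section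

variable {N : ℕ} {z c p q : Fin N → ℂ} {x t : ℝ}

theorem tendsto_matrix_of_entries {l : Filter ℂ} {F : ℂ → Matrix (Fin 2) (Fin 2) ℂ}
    {A : Matrix (Fin 2) (Fin 2) ℂ} (h : ∀ i j, Tendsto (fun ζ => F ζ i j) l (𝓝 (A i j))) :
    Tendsto F l (𝓝 A) :=
  tendsto_pi_nhds.2 fun i => tendsto_pi_nhds.2 fun j => h i j

/-- A solution of the residue system yields a solution of the Riemann-Hilbert problem. -/
theorem IsResidueSystem.isRHPSolution (hz : ∀ k, 0 < (z k).im) (hinj : Function.Injective z)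
    (h : IsResidueSystem z (residueConst z c x t) p q) :
    IsRHPSolution z c x t (residueMatrix z (residueConst z c x t) p q) := by
  obtain ⟨S, hS, hSmem⟩ := exists_finset_eq_poles z
  have hgdef : ∀ k, c k * exp (2 * I * theta (z k) x t) = residueConst z c x t k := fun k => rfl
  have hgdef' := conj_residueConst (z := z) (c := c) (x := x) (t := t)
  set g := residueConst z c x t with hg
  set zb : Fin N → ℂ := fun k => starRingEnd ℂ (z k) with hzb
  have hbinj : Function.Injective zb := conj_comp_injective hinj
  set m11 : ℂ → ℂ := fun ζ => 1 + cauchySum z (fun k => g k * q k) ζ with h11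
  set m12 : ℂ → ℂ := fun ζ => -cauchySum zb (fun k => starRingEnd ℂ (g k) * p k) ζ with h12
  -- The second row comes from the Schwarz symmetry `m21(ζ) = -conj(m12(conj ζ))`, `m22(ζ) =
  -- conj(m11(conj ζ))`, so the conjugated system gives its limits.
  set m21 : ℂ → ℂ := cauchySum z (fun k => g k * starRingEnd ℂ (p k)) with h21
  set m22 : ℂ → ℂ := fun ζ => 1 + cauchySum zb (fun k => starRingEnd ℂ (g k * q k)) ζ with h22
  have hM : residueMatrix z g p q = fun ζ => !![m11 ζ, m12 ζ; m21 ζ, m22 ζ] := rfl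
  rw [hM]
  have hne : ∀ ζ ∉ poles z, (∀ k, ζ ≠ z k) ∧ ∀ k, ζ ≠ zb k := fun ζ hζ =>
    ⟨fun k h => hζ ⟨k, Or.inl h⟩, fun k h => hζ ⟨k, Or.inr h⟩⟩
  have hd11 : ∀ ζ ∉ poles z, DifferentiableAt ℂ m11 ζ := fun ζ hζ =>
    (differentiableAt_const _).add (differentiableAt_cauchySum _ _ (hne ζ hζ).1)
  have hd12 : ∀ ζ ∉ poles z, DifferentiableAt ℂ m12 ζ := fun ζ hζ =>
    (differentiableAt_cauchySum _ _ (hne ζ hζ).2).neg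
  have hd21 : ∀ ζ ∉ poles z, DifferentiableAt ℂ m21 ζ := fun ζ hζ =>
    differentiableAt_cauchySum _ _ (hne ζ hζ).1
  have hd22 : ∀ ζ ∉ poles z, DifferentiableAt ℂ m22 ζ := fun ζ hζ =>
    (differentiableAt_const _).add (differentiableAt_cauchySum _ _ (hne ζ hζ).2)
  -- limits at the points `z k`
  have u12 : ∀ k, Tendsto m12 (𝓝[≠] (z k)) (𝓝 (q k)) := fun k => by
    rw [h.eq_q k]
    exact (tendsto_cauchySum zb _ (pole_ne_conj hz k)).neg
  have u22 : ∀ k, Tendsto m22 (𝓝[≠] (z k)) (𝓝 (starRingEnd ℂ (p k))) := fun k => by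
    have e : starRingEnd ℂ (p k) = m22 (z k) := by
      rw [h.eq_p k]; simp [h22, cauchySum, hzb]
    rw [e]
    exact tendsto_const_nhds.add (tendsto_cauchySum zb _ (pole_ne_conj hz k))
  have u11 : ∀ k, Tendsto (fun ζ => (ζ - z k) * m11 ζ) (𝓝[≠] (z k)) (𝓝 (g k * q k)) := fun k => by
    have := (tendsto_sub_self (z k)).add
      (tendsto_sub_mul_cauchySum z (fun k => g k * q k) hinj k)
    rw [zero_add] at this
    exact this.congr fun ζ => by simp only [h11]; ring
  have u21 : ∀ k, Tendsto (fun ζ => (ζ - z k) * m21 ζ) (𝓝[≠] (z k))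
      (𝓝 (g k * starRingEnd ℂ (p k))) := fun k => tendsto_sub_mul_cauchySum z _ hinj k
  -- limits at the points `conj (z k)`
  have l11 : ∀ k, Tendsto m11 (𝓝[≠] (zb k)) (𝓝 (p k)) := fun k => by
    rw [h.eq_p k]
    exact tendsto_const_nhds.add (tendsto_cauchySum z _ (conj_pole_ne hz k))
  have l21 : ∀ k, Tendsto m21 (𝓝[≠] (zb k)) (𝓝 (-starRingEnd ℂ (q k))) := fun k => by
    have e : -starRingEnd ℂ (q k) = m21 (zb k) := by
      rw [h.eq_q k]; simp [h21, cauchySum, hzb]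
    rw [e]
    exact tendsto_cauchySum z _ (conj_pole_ne hz k)
  have l12 : ∀ k, Tendsto (fun ζ => (ζ - zb k) * m12 ζ) (𝓝[≠] (zb k))
      (𝓝 (-(starRingEnd ℂ (g k) * p k))) := fun k => by
    exact (tendsto_sub_mul_cauchySum zb (fun k => starRingEnd ℂ (g k) * p k) hbinj k).neg.congr
      fun ζ => by simp only [h12]; ring
  have l22 : ∀ k, Tendsto (fun ζ => (ζ - zb k) * m22 ζ) (𝓝[≠] (zb k))
      (𝓝 (starRingEnd ℂ (g k * q k))) := fun k => by
    have := (tendsto_sub_self (zb k)).add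
      (tendsto_sub_mul_cauchySum zb (fun k => starRingEnd ℂ (g k * q k)) hbinj k)
    rw [zero_add] at this
    exact this.congr fun ζ => by simp only [h22]; ring
  refine ⟨fun ζ hζ => ?_, fun i j => ?_, fun i j => ?_, fun k => ?_, fun k => ?_⟩
  · rw [Matrix.det_fin_two_of]
    -- At each pole the residue of one column is proportional to the limit of the other, so the
    -- residue of the determinant cancels.
    refine sub_eq_zero.1 (eq_zero_of_removable_of_tendsto_zero S
      (fun ζ => m11 ζ * m22 ζ - m12 ζ * m21 ζ - 1) ?_ ?_ ?_ ζ ?_)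
    · rw [hS]
      intro w hw
      exact ((((hd11 w hw).mul (hd22 w hw)).sub
        ((hd12 w hw).mul (hd21 w hw))).sub_const 1).differentiableWithinAt
    · intro w hw
      obtain ⟨k, rfl | rfl⟩ := (hSmem w).1 hw
      · have := (((u11 k).mul (u22 k)).sub ((u12 k).mul (u21 k))).sub (tendsto_sub_self (z k))
        rw [show g k * q k * starRingEnd ℂ (p k) - q k * (g k * starRingEnd ℂ (p k)) - 0 = 0 by
          ring] at this
        exact this.congr fun ζ => by ring
      · have := (((l11 k).mul (l22 k)).sub ((l12 k).mul (l21 k))).sub (tendsto_sub_self (zb k))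
        rw [show p k * starRingEnd ℂ (g k * q k) -
            -(starRingEnd ℂ (g k) * p k) * -starRingEnd ℂ (q k) - 0 = 0 by
          rw [map_mul]; ring] at this
        exact this.congr fun ζ => by ring
    · have t1 := (tendsto_cauchySum_cobounded z (fun k => g k * q k)).const_add 1
      have t2 := (tendsto_cauchySum_cobounded zb (fun k => starRingEnd ℂ (g k) * p k)).neg
      have t3 := tendsto_cauchySum_cobounded z (fun k => g k * starRingEnd ℂ (p k))
      have t4 := (tendsto_cauchySum_cobounded zb (fun k => starRingEnd ℂ (g k * q k))).const_add 1
      have := ((t1.mul t4).sub (t2.mul t3)).sub_const 1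
      rwa [show ((1 : ℂ) + 0) * (1 + 0) - -0 * 0 - 1 = 0 by norm_num] at this
    · rw [← Finset.mem_coe, hS]; exact hζ
  · intro w hw
    refine DifferentiableAt.differentiableWithinAt ?_
    fin_cases i <;> fin_cases j
    exacts [hd11 w hw, hd12 w hw, hd21 w hw, hd22 w hw]
  · fin_cases i <;> fin_cases j
    · simpa [h11] using cauchySum_isBigO z (fun k => g k * q k)
    · simpa [h12] using cauchySum_isBigO zb (fun k => starRingEnd ℂ (g k) * p k)
    · simpa [h21] using cauchySum_isBigO z (fun k => g k * starRingEnd ℂ (p k))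
    · simpa [h22] using cauchySum_isBigO zb (fun k => starRingEnd ℂ (g k * q k))
  · rw [hgdef]
    refine ⟨!![q k, 0; starRingEnd ℂ (p k), 0], tendsto_matrix_of_entries fun i j => ?_,
      tendsto_matrix_of_entries fun i j => ?_⟩
    · fin_cases i <;> fin_cases j
      · simpa [Matrix.mul_apply] using u12 k
      · simp [Matrix.mul_apply]
      · simpa [Matrix.mul_apply] using u22 k
      · simp [Matrix.mul_apply]
    · fin_cases i <;> fin_cases j
      · simpa using u11 k
      · simpa using (tendsto_sub_self (z k)).mul (u12 k)
      · simpa using u21 k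
      · simpa using (tendsto_sub_self (z k)).mul (u22 k)
  · rw [← hgdef']
    refine ⟨!![0, p k; 0, -starRingEnd ℂ (q k)], tendsto_matrix_of_entries fun i j => ?_,
      tendsto_matrix_of_entries fun i j => ?_⟩
    · fin_cases i <;> fin_cases j
      · simp [Matrix.mul_apply]
      · simpa [Matrix.mul_apply] using l11 k
      · simp [Matrix.mul_apply]
      · simpa [Matrix.mul_apply] using l21 k
    · fin_cases i <;> fin_cases j
      · simpa using (tendsto_sub_self (zb k)).mul (l11 k)
      · simpa using l12 k
      · simpa using (tendsto_sub_self (zb k)).mul (l21 k)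
      · simpa using l22 k

/-- If the residue system is uniquely solvable, its solution gives the soliton solution. -/
theorem nSoliton_eq (hz : ∀ k, 0 < (z k).im) (hinj : Function.Injective z)
    (h : ∃ p q, IsResidueSystem z (residueConst z c x t) p q) :
    ∃ p q, IsResidueSystem z (residueConst z c x t) p q ∧
      nSoliton z c x t = -2 * I * ∑ k, starRingEnd ℂ (residueConst z c x t k) * p k := by
  obtain ⟨p, q, hpq⟩ := h
  have hex : ∃ w, IsNSolitonValue z c x t w :=
    ⟨_, _, hpq.isRHPSolution hz hinj, tendsto_solitonValue z _ fun ζ _ => rfl⟩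
  -- The choice operator may pick a different solution `M`, so `p, q` are extracted anew from the
  -- chosen value.
  exact (Classical.epsilon_spec hex).exists_residueSystem hz hinj

end

/-! ### Solving the nearly diagonal system. -/

section

variable {N : ℕ} {z g e p q : Fin N → ℂ} {ε : ℝ}

theorem norm_sum_offDiag_le {b : Fin N → ℂ} {d : Fin N → ℂ} {V : ℝ} (j : Fin N)
    (hV : ∀ k, ‖b k‖ ≤ V) (hε : ∑ k ∈ Finset.univ.erase j, ‖d k‖ ≤ ε) (hV0 : 0 ≤ V) :
    ‖∑ k ∈ Finset.univ.erase j, d k * b k‖ ≤ ε * V := by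
  calc ‖∑ k ∈ Finset.univ.erase j, d k * b k‖
      ≤ ∑ k ∈ Finset.univ.erase j, ‖d k‖ * V := by
        refine norm_sum_le_of_le _ fun k _ => ?_
        rw [norm_mul]
        exact mul_le_mul_of_nonneg_left (hV k) (norm_nonneg _)
    _ ≤ ε * V := by
        rw [← Finset.sum_mul]
        exact mul_le_mul_of_nonneg_right hε hV0

/-- A priori bound for the residue system when its off-diagonal part is small. -/
theorem residueSystem_bound (s : ℂ)
    (hp : ∀ j, p j = s + ∑ k, g k * q k / (starRingEnd ℂ (z j) - z k))
    (hq : ∀ j, q j = -∑ k, starRingEnd ℂ (g k) * p k / (z j - starRingEnd ℂ (z k)))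
    (hdiag : ∀ j, g j / (starRingEnd ℂ (z j) - z j) = -e j)
    (hoff : ∀ j, ∑ k ∈ Finset.univ.erase j, ‖g k / (starRingEnd ℂ (z j) - z k)‖ ≤ ε)
    (he : ∀ j, ‖e j‖ ≤ 2) (hε0 : 0 ≤ ε) (hε : ε ≤ 1 / 14) :
    ‖(p, q)‖ ≤ 4 * ‖s‖ ∧ ∀ j, ‖p j * (1 + ‖e j‖ ^ 2 : ℝ) - s‖ ≤ 12 * ε * ‖s‖ := by
  set V := ‖(p, q)‖ with hV
  have hV0 : 0 ≤ V := norm_nonneg _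
  have hpV : ∀ k, ‖p k‖ ≤ V := fun k => (norm_le_pi_norm p k).trans (norm_fst_le (p, q))
  have hqV : ∀ k, ‖q k‖ ≤ V := fun k => (norm_le_pi_norm q k).trans (norm_snd_le (p, q))
  have h1 : ∀ j, ‖p j + e j * q j - s‖ ≤ ε * V := fun j => by
    have : p j + e j * q j - s =
        ∑ k ∈ Finset.univ.erase j, g k / (starRingEnd ℂ (z j) - z k) * q k := by
      have h := hp j
      rw [← Finset.add_sum_erase _ _ (Finset.mem_univ j), mul_div_right_comm, hdiag] at h
      simp only [mul_div_right_comm (g _)] at h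
      rw [h]; ring
    rw [this]
    exact norm_sum_offDiag_le j hqV (hoff j) hV0
  have h2 : ∀ j, ‖q j - starRingEnd ℂ (e j) * p j‖ ≤ ε * V := fun j => by
    have hd : starRingEnd ℂ (g j) / (z j - starRingEnd ℂ (z j)) = -starRingEnd ℂ (e j) := by
      rw [← map_neg, ← hdiag]; simp
    have : q j - starRingEnd ℂ (e j) * p j = -∑ k ∈ Finset.univ.erase j,
        starRingEnd ℂ (g k) / (z j - starRingEnd ℂ (z k)) * p k := by
      have h := hq j
      rw [← Finset.add_sum_erase _ _ (Finset.mem_univ j), mul_div_right_comm, hd] at h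
      simp only [mul_div_right_comm (starRingEnd ℂ (g _))] at h
      rw [h]; ring
    rw [this, norm_neg]
    refine norm_sum_offDiag_le j hpV ?_ hV0
    refine le_trans (le_of_eq (Finset.sum_congr rfl fun k _ => ?_)) (hoff j)
    rw [← norm_conj]
    simp
  -- Eliminating `q j` from the 2×2 block costs a factor `1 + ‖e j‖ ≤ 3`.
  have h3 : ∀ j, ‖p j * (1 + ‖e j‖ ^ 2 : ℝ) - s‖ ≤ 3 * (ε * V) := fun j => by
    have : p j * (1 + ‖e j‖ ^ 2 : ℝ) - s =
        (p j + e j * q j - s) - e j * (q j - starRingEnd ℂ (e j) * p j) := by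
      push_cast
      rw [← mul_conj']
      ring
    rw [this]
    refine (norm_sub_le _ _).trans ?_
    rw [norm_mul]
    have := mul_le_mul (he j) (h2 j) (norm_nonneg _) zero_le_two
    linarith [h1 j]
  have h4 : ∀ j, ‖p j‖ ≤ ‖s‖ + 3 * (ε * V) := fun j => by
    have h5 : ‖p j‖ ≤ ‖p j * (1 + ‖e j‖ ^ 2 : ℝ)‖ := by
      rw [norm_mul, norm_real, Real.norm_of_nonneg (by positivity)]
      exact le_mul_of_one_le_right (norm_nonneg _) (by nlinarith [sq_nonneg ‖e j‖])
    have h6 := norm_le_norm_add_norm_sub s (p j * (1 + ‖e j‖ ^ 2 : ℝ))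
    rw [norm_sub_rev] at h6
    linarith [h3 j]
  have hεV : 0 ≤ ε * V := mul_nonneg hε0 hV0
  -- The `q` components dominate: `2 (‖s‖ + 3 ε V) + ε V`. The threshold `1 / 14` turns `7 ε V` into
  -- at most `V / 2`, which is absorbed on the left.
  have h7 : V ≤ 2 * ‖s‖ + 7 * (ε * V) := by
    have hpos : 0 ≤ 2 * ‖s‖ + 7 * (ε * V) := by positivity
    refine norm_prod_le_iff.2 ⟨(pi_norm_le_iff_of_nonneg hpos).2 fun j => ?_,
      (pi_norm_le_iff_of_nonneg hpos).2 fun j => ?_⟩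
    · linarith [h4 j, norm_nonneg s]
    · have h8 := norm_le_norm_add_norm_sub (starRingEnd ℂ (e j) * p j) (q j)
      rw [norm_sub_rev, norm_mul, norm_conj] at h8
      have := mul_le_mul (he j) (h4 j) (norm_nonneg _) zero_le_two
      linarith [h2 j]
  have h8 : ε * V ≤ 1 / 14 * V := mul_le_mul_of_nonneg_right hε hV0
  have h9 : V ≤ 4 * ‖s‖ := by linarith
  refine ⟨h9, fun j => (h3 j).trans ?_⟩
  have := mul_le_mul_of_nonneg_left h9 hε0
  linarith

/-- The residue system is solvable when its off-diagonal part is small. -/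
theorem exists_residueSystem
    (hdiag : ∀ j, g j / (starRingEnd ℂ (z j) - z j) = -e j)
    (hoff : ∀ j, ∑ k ∈ Finset.univ.erase j, ‖g k / (starRingEnd ℂ (z j) - z k)‖ ≤ ε)
    (he : ∀ j, ‖e j‖ ≤ 2) (hε0 : 0 ≤ ε) (hε : ε ≤ 1 / 14) :
    ∃ p q, IsResidueSystem z g p q := by
  let L : ((Fin N → ℂ) × (Fin N → ℂ)) →ₗ[ℂ] ((Fin N → ℂ) × (Fin N → ℂ)) :=
    { toFun := fun v =>
        (fun j => v.1 j - ∑ k, g k * v.2 k / (starRingEnd ℂ (z j) - z k),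
          fun j => v.2 j + ∑ k, starRingEnd ℂ (g k) * v.1 k / (z j - starRingEnd ℂ (z k)))
      map_add' := fun u v => by
        ext j
        · simp only [Prod.fst_add, Prod.snd_add, Pi.add_apply, mul_add, add_div,
            Finset.sum_add_distrib]
          ring
        · simp only [Prod.fst_add, Prod.snd_add, Pi.add_apply, mul_add, add_div,
            Finset.sum_add_distrib]
          ring
      map_smul' := fun a v => by
        ext j
        · simp only [Prod.smul_fst, Prod.smul_snd, Pi.smul_apply, smul_eq_mul, RingHom.id_apply,
            mul_sub, Finset.mul_sum]
          congr 1
          exact Finset.sum_congr rfl fun k _ => by ring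
        · simp only [Prod.smul_fst, Prod.smul_snd, Pi.smul_apply, smul_eq_mul, RingHom.id_apply,
            mul_add, Finset.mul_sum]
          congr 1
          exact Finset.sum_congr rfl fun k _ => by ring }
  -- The a priori bound with `s = 0` kills the kernel; in finite dimension injectivity gives
  -- surjectivity.
  have hinj : Function.Injective L := by
    rw [← LinearMap.ker_eq_bot, LinearMap.ker_eq_bot']
    rintro ⟨p, q⟩ h
    have hp : ∀ j, p j - ∑ k, g k * q k / (starRingEnd ℂ (z j) - z k) = 0 := fun j =>
      congrFun (congrArg Prod.fst h) j
    have hq : ∀ j, q j + ∑ k, starRingEnd ℂ (g k) * p k / (z j - starRingEnd ℂ (z k)) = 0 :=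
      fun j => congrFun (congrArg Prod.snd h) j
    have := (residueSystem_bound (s := 0) (fun j => by rw [zero_add]; exact sub_eq_zero.1 (hp j))
      (fun j => eq_neg_of_add_eq_zero_left (hq j)) hdiag hoff he hε0 hε).1
    rw [norm_zero, mul_zero] at this
    exact norm_le_zero_iff.1 this
  obtain ⟨⟨p, q⟩, h⟩ := LinearMap.injective_iff_surjective.1 hinj (fun _ => 1, fun _ => 0)
  have hp : ∀ j, p j - ∑ k, g k * q k / (starRingEnd ℂ (z j) - z k) = 1 := fun j =>
    congrFun (congrArg Prod.fst h) j
  have hq : ∀ j, q j + ∑ k, starRingEnd ℂ (g k) * p k / (z j - starRingEnd ℂ (z k)) = 0 :=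
    fun j => congrFun (congrArg Prod.snd h) j
  exact ⟨p, q, fun j => sub_eq_iff_eq_add.1 (hp j), fun j => eq_neg_of_add_eq_zero_left (hq j)⟩

end

/-! ### Harmonic sums, phases and norming constants. -/

section

variable {N : ℕ}

theorem sum_inv_le_one_add_log {ι : Type*} {s : Finset ι} (f : ι → ℕ) (hf : Set.InjOn f s)
    (hlt : ∀ k ∈ s, f k < N) : ∑ k ∈ s, ((f k : ℝ) + 1)⁻¹ ≤ 1 + Real.log N := by
  classical
  have h : ∑ k ∈ s, ((f k : ℝ) + 1)⁻¹ = ∑ i ∈ s.image f, ((i : ℝ) + 1)⁻¹ :=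
    (Finset.sum_image (f := fun i : ℕ => ((i : ℝ) + 1)⁻¹) hf).symm
  refine le_trans (h ▸ Finset.sum_le_sum_of_subset_of_nonneg (t := Finset.range N) ?_ ?_)
    (le_trans (le_of_eq ?_) (harmonic_le_one_add_log N))
  · simp [harmonic]
  · intro i hi
    obtain ⟨k, hk, rfl⟩ := Finset.mem_image.1 hi
    exact Finset.mem_range.2 (hlt k hk)
  · intro i _ _; positivity

/-- On each side of `j` the distances `|k - j|` are distinct positive integers below `N`, so each
half is bounded by a harmonic sum. This is the source of the logarithm in `ε`. -/
theorem sum_inv_abs_sub_le (j : Fin N) :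
    ∑ k ∈ Finset.univ.erase j, |((k : ℕ) : ℝ) - ((j : ℕ) : ℝ)|⁻¹ ≤ 2 * (1 + Real.log N) := by
  rw [← Finset.sum_filter_add_sum_filter_not _ (fun k : Fin N => (k : ℕ) < j), two_mul]
  refine add_le_add ?_ ?_
  · refine le_trans (le_of_eq (Finset.sum_congr rfl fun k hk => ?_))
      (sum_inv_le_one_add_log (s := (Finset.univ.erase j).filter fun k : Fin N => (k : ℕ) < j)
        (fun k : Fin N => (j : ℕ) - k - 1) ?_ ?_)
    · have hlt : (k : ℕ) < j := (Finset.mem_filter.1 hk).2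
      have e : (((j : ℕ) - k - 1 : ℕ) : ℝ) + 1 = ((j : ℕ) : ℝ) - ((k : ℕ) : ℝ) := by
        have : ((j : ℕ) - k - 1 : ℕ) + 1 + (k : ℕ) = j := by omega
        have h2 : (((j : ℕ) - k - 1 : ℕ) : ℝ) + 1 + ((k : ℕ) : ℝ) = ((j : ℕ) : ℝ) := by
          exact_mod_cast this
        linarith
      rw [e, abs_sub_comm, abs_of_pos (sub_pos.2 (by exact_mod_cast hlt))]
    · intro k hk l hl h
      have h1 : (k : ℕ) < j := (Finset.mem_filter.1 hk).2
      have h2 : (l : ℕ) < j := (Finset.mem_filter.1 hl).2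
      ext; dsimp only at h; omega
    · intro k _; have := j.2; omega
  · refine le_trans (le_of_eq (Finset.sum_congr rfl fun k hk => ?_))
      (sum_inv_le_one_add_log (s := (Finset.univ.erase j).filter fun k : Fin N => ¬ (k : ℕ) < j)
        (fun k : Fin N => (k : ℕ) - j - 1) ?_ ?_)
    · have hlt : (j : ℕ) < k := by
        have h1 := (Finset.mem_filter.1 hk).2
        have h2 : k ≠ j := Finset.ne_of_mem_erase (Finset.mem_filter.1 hk).1
        have h3 : (k : ℕ) ≠ j := fun h => h2 (Fin.ext h)
        omega
      have e : (((k : ℕ) - j - 1 : ℕ) : ℝ) + 1 = ((k : ℕ) : ℝ) - ((j : ℕ) : ℝ) := by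
        have : ((k : ℕ) - j - 1 : ℕ) + 1 + (j : ℕ) = k := by omega
        have h2 : (((k : ℕ) - j - 1 : ℕ) : ℝ) + 1 + ((j : ℕ) : ℝ) = ((k : ℕ) : ℝ) := by
          exact_mod_cast this
        linarith
      rw [e, abs_of_pos (sub_pos.2 (by exact_mod_cast hlt))]
    · have hlt : ∀ k ∈ (Finset.univ.erase j).filter (fun k : Fin N => ¬ (k : ℕ) < j),
          (j : ℕ) < k := fun k hk => by
        have h1 := (Finset.mem_filter.1 hk).2
        have h2 : k ≠ j := Finset.ne_of_mem_erase (Finset.mem_filter.1 hk).1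
        have h3 : (k : ℕ) ≠ j := fun h => h2 (Fin.ext h)
        omega
      intro k hk l hl h
      have h1 := hlt k hk
      have h2 := hlt l hl
      ext; dsimp only at h; omega
    · intro k _; have := k.2; omega

/-- The oscillating factor `exp (i (2 X s - T s² / 2))`. -/
noncomputable def wave (X T s : ℝ) : ℂ := exp (I * ((2 * X * s - T / 2 * s ^ 2 : ℝ) : ℂ))

theorem norm_wave (X T s : ℝ) : ‖wave X T s‖ = 1 := by
  rw [wave, mul_comm, norm_exp_ofReal_mul_I]

/-- The correction to the phase due to the imaginary part of the poles. -/
noncomputable def phaseError (X T s r : ℝ) : ℂ :=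
  ((-2 * X * r + T * s * r : ℝ) : ℂ) - I * ((T * r ^ 2 / 2 : ℝ) : ℂ)

theorem norm_phaseError_le {X T s r : ℝ} (hs0 : 0 ≤ s) (hs1 : s ≤ 1) (hr0 : 0 ≤ r) (hr1 : r ≤ 1) :
    ‖phaseError X T s r‖ ≤ 2 * (|X| + |T|) * r := by
  refine (norm_sub_le _ _).trans ?_
  rw [norm_mul, norm_I, one_mul, norm_real, norm_real, Real.norm_eq_abs, Real.norm_eq_abs]
  have h1 : |-2 * X * r + T * s * r| ≤ 2 * |X| * r + |T| * r := by
    refine (abs_add_le _ _).trans (add_le_add (le_of_eq ?_) ?_)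
    · rw [abs_mul, abs_mul, abs_of_nonneg hr0]; norm_num
    · rw [abs_mul, abs_mul, abs_of_nonneg hr0, abs_of_nonneg hs0]
      exact mul_le_mul_of_nonneg_right (mul_le_of_le_one_right (abs_nonneg _) hs1) hr0
  have h2 : |T * r ^ 2 / 2| ≤ |T| * r := by
    rw [abs_div, abs_mul, abs_of_nonneg (sq_nonneg r), abs_two]
    have : |T| * r ^ 2 ≤ |T| * r :=
      mul_le_mul_of_nonneg_left (by nlinarith) (abs_nonneg T)
    have : 0 ≤ |T| * r := by positivity
    linarith
  linarith

/-- The factor `exp (-2 i z_k²)` cancels the `t = 1` part of the phase. With `s = (k + 1) / N` and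
`r = a_k / (Δ N)`, `z_k / (Δ N) = (-s + i r) / 2`; the terms free of `r` form the conjugate wave and
the rest is `phaseError`. -/
theorem residueConst_pole {Δ : ℝ} (hΔ : Δ ≠ 0) (hN : N ≠ 0) (a : Fin N → ℝ) (X T : ℝ)
    (k : Fin N) :
    residueConst (pole Δ a) (norming Δ a) (2 * X / (Δ * N)) (1 + T / (Δ ^ 2 * (N : ℝ) ^ 2)) k =
      I * (a k : ℂ) * (starRingEnd ℂ (wave X T ((((k : ℕ) : ℝ) + 1) / N)) *
        exp (phaseError X T ((((k : ℕ) : ℝ) + 1) / N) (a k / (Δ * N)))) := by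
  have hΔ' : (Δ : ℂ) ≠ 0 := ofReal_ne_zero.2 hΔ
  have hN' : (N : ℂ) ≠ 0 := Nat.cast_ne_zero.2 hN
  rw [residueConst, norming, mul_assoc, ← exp_add, wave, ← exp_conj, ← exp_add]
  congr 2
  simp only [theta, pole, phaseError, map_mul, conj_I, conj_ofReal]
  push_cast
  have hI : I ^ 2 = -1 := I_sq
  have hI3 : I ^ 3 = -I := I_pow_three
  field_simp
  ring_nf
  simp only [hI, hI3]
  ring

end

/-! ### The soliton solution as an approximate superposition. -/

section

variable {N : ℕ} {Δ : ℝ} {a : Fin N → ℝ}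

theorem pole_re (k : Fin N) : (pole Δ a k).re = -((((k : ℕ) : ℝ) + 1) * Δ) / 2 := by
  simp [pole, -ofReal_mul, -ofReal_add, -neg_mul, ← ofReal_neg]

theorem pole_im (k : Fin N) : (pole Δ a k).im = a k / 2 := by
  simp [pole, -ofReal_mul, -ofReal_add, -neg_mul, ← ofReal_neg]

theorem pole_injective (hΔ : 0 < Δ) : Function.Injective (pole Δ a) := by
  intro j k h
  have h1 := congrArg Complex.re h
  rw [pole_re, pole_re] at h1
  have h2 : (((j : ℕ) : ℝ) - ((k : ℕ) : ℝ)) * Δ = 0 := by linarith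
  have h3 := (mul_eq_zero.1 h2).resolve_right hΔ.ne'
  exact Fin.ext (by exact_mod_cast sub_eq_zero.1 h3)

theorem conj_pole_sub_self (k : Fin N) :
    starRingEnd ℂ (pole Δ a k) - pole Δ a k = -(I * (a k : ℂ)) := by
  apply Complex.ext
  · simp
  · simp [pole_im]; ring

/-- Only the real parts are used, so the separation does not depend on the amplitudes. -/
theorem norm_conj_pole_sub_ge (hΔ : 0 < Δ) (j k : Fin N) :
    Δ / 2 * |((k : ℕ) : ℝ) - ((j : ℕ) : ℝ)| ≤ ‖starRingEnd ℂ (pole Δ a j) - pole Δ a k‖ := by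
  refine le_trans (le_of_eq ?_) (abs_re_le_norm _)
  rw [sub_re, conj_re, pole_re, pole_re, ← abs_of_pos (half_pos hΔ), ← abs_mul]
  congr 1; ring

/-- The soliton solution is close to the superposition of its `N` solitons as soon as the
amplitudes are small compared to the spacing of the velocities. -/
theorem norm_syncSoliton_add_le (hN : N ≠ 0) (hΔ : 0 < Δ) {B X T ε : ℝ} (ha0 : ∀ k, 0 < a k)
    (haB : ∀ k, a k ≤ B) (hεdef : ε = 8 * B * (1 + Real.log N) / Δ) (hε : ε ≤ 1 / 14)
    (hεXT : (|X| + |T|) * ε ≤ 1) :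
    ‖syncSoliton Δ a (2 * X / (Δ * N)) (1 + T / (Δ ^ 2 * (N : ℝ) ^ 2)) +
        ∑ k : Fin N, (a k : ℂ) * wave X T ((((k : ℕ) : ℝ) + 1) / N)‖ ≤
      (12 + 10 * (|X| + |T|)) * ε * ∑ k, a k := by
  set x := 2 * X / (Δ * N) with hx
  set t := 1 + T / (Δ ^ 2 * (N : ℝ) ^ 2) with ht
  set C := |X| + |T| with hC
  have hC0 : 0 ≤ C := by positivity
  have hN1 : (1 : ℝ) ≤ N := by exact_mod_cast Nat.one_le_iff_ne_zero.2 hN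
  have hlog : 0 ≤ Real.log N := Real.log_nonneg hN1
  have hB0 : 0 ≤ B := (ha0 ⟨0, Nat.pos_of_ne_zero hN⟩).le.trans (haB _)
  have hε0 : 0 ≤ ε := by rw [hεdef]; positivity
  have hBε : 8 * (B / Δ) ≤ ε := by
    rw [hεdef, mul_div_assoc', div_le_div_iff_of_pos_right hΔ]
    exact le_mul_of_one_le_right (by positivity) (by linarith)
  let s : Fin N → ℝ := fun k => (((k : ℕ) : ℝ) + 1) / N
  let d : Fin N → ℂ := fun k => phaseError X T (s k) (a k / (Δ * N))
  let e : Fin N → ℂ := fun k => starRingEnd ℂ (wave X T (s k)) * exp (d k)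
  have hg : ∀ k, residueConst (pole Δ a) (norming Δ a) x t k = I * (a k : ℂ) * e k :=
    fun k => residueConst_pole hΔ.ne' hN a X T k
  set g := residueConst (pole Δ a) (norming Δ a) x t with hgdef
  have hr : ∀ k, a k / (Δ * N) ≤ ε / 8 := fun k => by
    have h1 : a k / (Δ * N) ≤ B / Δ :=
      div_le_div₀ hB0 (haB k) hΔ (le_mul_of_one_le_right hΔ.le hN1)
    linarith
  have hd : ∀ k, ‖d k‖ ≤ C * ε / 4 := fun k => by
    have hs1 : s k ≤ 1 := by
      rw [div_le_one (by linarith)]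
      exact_mod_cast k.2
    have h := norm_phaseError_le (X := X) (T := T) (s := s k) (r := a k / (Δ * N))
      (by positivity) hs1 (by have := ha0 k; positivity) ((hr k).trans (by linarith))
    have h2 := mul_le_mul_of_nonneg_left (hr k) (by positivity : 0 ≤ 2 * C)
    linarith
  have hE : ∀ k, ‖exp (d k) - 1‖ ≤ C * ε / 2 := fun k =>
    (norm_exp_sub_one_le ((hd k).trans (by linarith))).trans (by linarith [hd k])
  have hρ : ∀ k, ‖e k‖ = ‖exp (d k)‖ := fun k => by
    rw [norm_mul, norm_conj, norm_wave, one_mul]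
  have hρ1 : ∀ k, |‖e k‖ - 1| ≤ C * ε / 2 := fun k => by
    rw [hρ, ← norm_one (α := ℂ)]
    exact (abs_norm_sub_norm_le _ _).trans (hE k)
  have he2 : ∀ k, ‖e k‖ ≤ 2 := fun k => by linarith [(abs_le.1 (hρ1 k)).2]
  have hdiag : ∀ j, g j / (starRingEnd ℂ (pole Δ a j) - pole Δ a j) = -e j := fun j => by
    have : I * (a j : ℂ) ≠ 0 := mul_ne_zero I_ne_zero (ofReal_ne_zero.2 (ha0 j).ne')
    rw [hg, conj_pole_sub_self, div_neg, mul_div_cancel_left₀ _ this]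
  have hoff : ∀ j, ∑ k ∈ Finset.univ.erase j,
      ‖g k / (starRingEnd ℂ (pole Δ a j) - pole Δ a k)‖ ≤ ε := fun j => by
    -- Here `‖g k‖ ≤ 2 B` is divided by `Δ |k - j| / 2`; the two-sided harmonic sum doubles the
    -- constant 4, giving the 8 in `ε`.
    have h1 : ∀ k ∈ Finset.univ.erase j, ‖g k / (starRingEnd ℂ (pole Δ a j) - pole Δ a k)‖ ≤
        4 * B / Δ * |((k : ℕ) : ℝ) - ((j : ℕ) : ℝ)|⁻¹ := fun k hk => by
      have hkj : ((k : ℕ) : ℝ) - ((j : ℕ) : ℝ) ≠ 0 := fun h =>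
        Finset.ne_of_mem_erase hk (Fin.ext (by exact_mod_cast sub_eq_zero.1 h))
      have hpos : 0 < |((k : ℕ) : ℝ) - ((j : ℕ) : ℝ)| := abs_pos.2 hkj
      have hgk : ‖g k‖ ≤ B * 2 := by
        rw [hg, norm_mul, norm_mul, norm_I, one_mul, norm_real, Real.norm_of_nonneg (ha0 k).le]
        exact mul_le_mul (haB k) (he2 k) (norm_nonneg _) hB0
      rw [norm_div]
      refine (div_le_div₀ (by positivity) hgk (by positivity)
        (norm_conj_pole_sub_ge hΔ j k)).trans (le_of_eq ?_)
      field_simp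
      norm_num
    refine (Finset.sum_le_sum h1).trans ?_
    rw [← Finset.mul_sum]
    refine (mul_le_mul_of_nonneg_left (sum_inv_abs_sub_le j) (by positivity)).trans (le_of_eq ?_)
    rw [hεdef]; ring
  obtain ⟨p, q, hpq, hψ⟩ := nSoliton_eq (z := pole Δ a) (c := norming Δ a) (x := x) (t := t)
    (fun k => by rw [pole_im]; linarith [ha0 k]) (pole_injective hΔ)
    (exists_residueSystem hdiag hoff he2 hε0 hε)
  obtain ⟨hV, hP⟩ := residueSystem_bound 1 hpq.eq_p hpq.eq_q hdiag hoff he2 hε0 hε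
  rw [norm_one, mul_one] at hV
  have hp4 : ∀ k, ‖p k‖ ≤ 4 := fun k =>
    ((norm_le_pi_norm p k).trans (norm_fst_le (p, q))).trans hV
  have hterm : ∀ k, ‖1 - 2 * starRingEnd ℂ (exp (d k)) * p k‖ ≤ (12 + 10 * C) * ε := fun k => by
    -- Three deviations from `p = 1/2`: coupling between solitons (`12 ε`), `‖e k‖ ≠ 1` (`6 C ε`)
    -- and the phase error (`4 C ε`).
    have h1 : 1 - 2 * starRingEnd ℂ (exp (d k)) * p k =
        -(p k * (1 + ‖e k‖ ^ 2 : ℝ) - 1) + p k * ((‖e k‖ - 1) * (‖e k‖ + 1) : ℝ) -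
          2 * (starRingEnd ℂ (exp (d k) - 1) * p k) := by
      rw [map_sub, map_one]; push_cast; ring
    have h2 : ‖p k * ((‖e k‖ - 1) * (‖e k‖ + 1) : ℝ)‖ ≤ 4 * (C * ε / 2 * 3) := by
      rw [norm_mul, norm_real, Real.norm_eq_abs, abs_mul]
      refine mul_le_mul (hp4 k) (mul_le_mul (hρ1 k) ?_ (abs_nonneg _) (by positivity))
        (by positivity) (by norm_num)
      rw [abs_of_nonneg (by positivity)]
      linarith [he2 k]
    have h3 : ‖2 * (starRingEnd ℂ (exp (d k) - 1) * p k)‖ ≤ 2 * (C * ε / 2 * 4) := by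
      rw [norm_mul, norm_mul, norm_conj, norm_ofNat]
      exact mul_le_mul_of_nonneg_left (mul_le_mul (hE k) (hp4 k) (norm_nonneg _) (by positivity))
        zero_le_two
    have h4 := hP k
    rw [norm_one, mul_one] at h4
    rw [h1]
    refine (norm_sub_le _ _).trans ?_
    have h5 := norm_add_le (-(p k * (1 + ‖e k‖ ^ 2 : ℝ) - 1))
      (p k * ((‖e k‖ - 1) * (‖e k‖ + 1) : ℝ))
    rw [norm_neg] at h5
    linarith
  have hsum : syncSoliton Δ a x t + ∑ k : Fin N, (a k : ℂ) * wave X T (s k) =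
      ∑ k : Fin N, (a k : ℂ) * wave X T (s k) * (1 - 2 * starRingEnd ℂ (exp (d k)) * p k) := by
    rw [syncSoliton, hψ, Finset.mul_sum, ← Finset.sum_add_distrib]
    refine Finset.sum_congr rfl fun k _ => ?_
    rw [← hgdef, hg]
    simp only [e, map_mul, conj_I, conj_ofReal, conj_conj]
    ring_nf
    rw [I_sq]
    ring
  rw [hsum, Finset.mul_sum]
  refine norm_sum_le_of_le _ fun k _ => ?_
  rw [norm_mul, norm_mul, norm_wave, mul_one, norm_real, Real.norm_of_nonneg (ha0 k).le, mul_comm]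
  exact mul_le_mul_of_nonneg_right (hterm k) (ha0 k).le

end

/-! ### Riemann sums, the profile at `T = 0`, and the decay of `ε`. -/

/-- Convergence of the right Riemann sums of a continuous function on `[0, 1]`. -/
theorem tendsto_riemannSum {f : ℝ → ℂ} (hf : Continuous f) :
    Tendsto (fun N : ℕ => (1 / (N : ℂ)) * ∑ k : Fin N, f ((((k : ℕ) : ℝ) + 1) / N)) atTop
      (𝓝 (∫ s in (0 : ℝ)..1, f s)) := by
  rw [Metric.tendsto_atTop]
  intro ε hε
  obtain ⟨δ, hδ, hfδ⟩ := Metric.uniformContinuousOn_iff.1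
    (isCompact_Icc.uniformContinuousOn_of_continuous (hf.continuousOn (s := Set.Icc (0 : ℝ) 1)))
    (ε / 2) (half_pos hε)
  obtain ⟨n, hn⟩ := exists_nat_gt (1 / δ)
  refine ⟨n + 1, fun N hN => ?_⟩
  have hNn : (n : ℝ) + 1 ≤ N := by exact_mod_cast hN
  have hNpos : (0 : ℝ) < N := by linarith [(Nat.cast_nonneg n : (0 : ℝ) ≤ n)]
  have hNδ : 1 / (N : ℝ) < δ := by
    rw [div_lt_comm₀ hNpos hδ]
    linarith
  have hsplit : ∫ s in (0 : ℝ)..1, f s =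
      ∑ k ∈ Finset.range N, ∫ s in ((k : ℝ) / N)..(((k : ℝ) + 1) / N), f s := by
    have := intervalIntegral.sum_integral_adjacent_intervals (f := f) (μ := volume)
      (a := fun k : ℕ => (k : ℝ) / N) (n := N) fun k _ => hf.intervalIntegrable _ _
    simp only [Nat.cast_zero, zero_div, div_self hNpos.ne', Nat.cast_add, Nat.cast_one] at this
    exact this.symm
  rw [dist_eq_norm, hsplit, Fin.sum_univ_eq_sum_range (fun k => f (((k : ℝ) + 1) / N)),
    Finset.mul_sum, ← Finset.sum_sub_distrib]
  refine lt_of_le_of_lt (norm_sum_le_of_le _ (fun k hk => ?_) :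
    _ ≤ ∑ _k ∈ Finset.range N, ε / 2 * (1 / N)) ?_
  · have hkN : (k : ℝ) + 1 ≤ N := by exact_mod_cast Finset.mem_range.1 hk
    have hle : (k : ℝ) / N ≤ ((k : ℝ) + 1) / N := by
      rw [div_le_div_iff_of_pos_right hNpos]; linarith
    have hlen : ((k : ℝ) + 1) / N - (k : ℝ) / N = 1 / N := by ring
    have h1 : 1 / (N : ℂ) * f (((k : ℝ) + 1) / N) =
        ∫ _ in ((k : ℝ) / N)..(((k : ℝ) + 1) / N), f (((k : ℝ) + 1) / N) := by
      rw [intervalIntegral.integral_const, hlen, real_smul]; push_cast; rfl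
    rw [h1, ← intervalIntegral.integral_sub (by simp) (hf.intervalIntegrable _ _)]
    refine (intervalIntegral.norm_integral_le_of_norm_le_const fun s hs => ?_).trans
      (le_of_eq (by rw [hlen, abs_of_pos (by positivity)]))
    rw [Set.uIoc_of_le hle] at hs
    have hk0 : 0 ≤ (k : ℝ) / N := by positivity
    have hk1 : ((k : ℝ) + 1) / N ≤ 1 := (div_le_one hNpos).2 hkN
    rw [← dist_eq_norm]
    refine (hfδ _ ⟨by positivity, hk1⟩ s ⟨hk0.trans hs.1.le, hs.2.trans hk1⟩ ?_).le
    rw [Real.dist_eq, abs_of_nonneg (by linarith [hs.2])]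
    linarith [hs.1]
  · rw [Finset.sum_const, Finset.card_range, nsmul_eq_mul]
    field_simp
    linarith

theorem continuous_wave (X T : ℝ) : Continuous (wave X T) := by
  unfold wave; fun_prop

theorem fresnel_zero (X : ℝ) :
    fresnel X 0 = -((Real.sinc X : ℝ) : ℂ) * exp (I * (X : ℂ)) := by
  rcases eq_or_ne X 0 with rfl | hX
  · simp [fresnel]
  · have hX' : (X : ℂ) ≠ 0 := ofReal_ne_zero.2 hX
    have hc : 2 * I * (X : ℂ) ≠ 0 := by simp [hX']
    have h1 : ∀ s : ℝ, exp (I * ((2 * X * s - 0 / 2 * s ^ 2 : ℝ) : ℂ)) =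
        exp (2 * I * (X : ℂ) * s) := fun s => by congr 1; push_cast; ring
    rw [fresnel, Real.sinc_of_ne_zero hX]
    simp only [h1]
    rw [integral_exp_mul_complex hc]
    push_cast
    rw [Complex.sin]
    have h2 : exp (2 * I * (X : ℂ) * 1) = exp (I * X) * exp (I * X) := by
      rw [← exp_add]; congr 1; ring
    have h3 : exp (-(I * (X : ℂ))) * exp (I * X) = 1 := by
      rw [← exp_add, ← exp_zero]; congr 1; ring
    rw [h2, mul_zero, exp_zero, mul_comm (X : ℂ) I]
    have hI : I ^ 2 = -1 := I_sq
    field_simp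
    linear_combination (exp (I * X) * exp (-(I * X)) - exp (I * X) ^ 2) * hI - h3

/-- `8 B_N (1 + log N) / Δ_N → 0` for `B_N = N ^ a` and `Δ_N = β N ^ γ` with `a < γ`. -/
theorem tendsto_rpow_mul_log_div_spacing {a β γ : ℝ} (hβ : β ≠ 0) (h : a < γ) :
    Tendsto (fun N : ℕ => 8 * (N : ℝ) ^ a * (1 + Real.log N) / spacing β γ N) atTop (𝓝 0) := by
  have h1 : Tendsto (fun x : ℝ => x ^ (-(γ - a))) atTop (𝓝 0) :=
    tendsto_rpow_neg_atTop (sub_pos.2 h)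
  have h2 : Tendsto (fun x : ℝ => Real.log x / x ^ (γ - a)) atTop (𝓝 0) :=
    (isLittleO_log_rpow_atTop (sub_pos.2 h)).tendsto_div_nhds_zero
  -- The quotient is `8 / β` times `N ^ (-(γ - a)) + log N / N ^ (γ - a)`.
  have h3 := (h1.add h2).const_mul (8 / β)
  rw [add_zero, mul_zero] at h3
  refine (h3.comp tendsto_natCast_atTop_atTop).congr' ?_
  filter_upwards [eventually_gt_atTop 0] with N hN
  have hN' : (0 : ℝ) < N := by exact_mod_cast hN
  have e1 : (N : ℝ) ^ γ = (N : ℝ) ^ a * (N : ℝ) ^ (γ - a) := by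
    rw [← Real.rpow_add hN']; congr 1; ring
  have p1 : (N : ℝ) ^ a ≠ 0 := (Real.rpow_pos_of_pos hN' _).ne'
  have p2 : (N : ℝ) ^ (γ - a) ≠ 0 := (Real.rpow_pos_of_pos hN' _).ne'
  simp only [Function.comp, spacing, e1, Real.rpow_neg hN'.le]
  field_simp

/-! ### Moments, law of large numbers and the maximal amplitude. -/

theorem IsSubExponential.memLp_two {D : Measure ℝ} [IsProbabilityMeasure D] {ν α : ℝ}
    (h : IsSubExponential D ν α) : MemLp (fun y => y) 2 D := by
  have hα := h.alpha_nonneg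
  set m := ∫ u, u ∂D
  -- This choice satisfies `α l < 1` also when `α = 0`; exponential moments at `l` and `-l` control
  -- the square.
  set l : ℝ := (α + 1)⁻¹ with hl
  have hlpos : 0 < l := by positivity
  have hαl : α * |l| < 1 := by
    rw [abs_of_pos hlpos, hl, ← div_eq_mul_inv, div_lt_one (by linarith)]
    linarith
  have hsq : Integrable (fun y => (y - m) ^ 2) D :=
    integrable_pow_of_integrable_exp_mul (X := fun y => y - m) hlpos.ne' (h.integrable_exp l hαl)
      (h.integrable_exp (-l) (by rwa [abs_neg])) 2
  have h1 : MemLp (fun y => y - m) 2 D :=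
    (memLp_two_iff_integrable_sq (by fun_prop)).2 hsq
  have h2 := h1.add (memLp_const m)
  refine (memLp_congr_ae (Eventually.of_forall fun y => ?_)).1 h2
  simp

section

variable {Ω : Type*} [MeasurableSpace Ω] {P : Measure Ω} {D : Measure ℝ}

theorem memLp_of_hasLaw {X : Ω → ℝ} (hX : HasLaw X D P) (hD : MemLp (fun y => y) 2 D) :
    MemLp X 2 P := by
  have : MemLp (fun y : ℝ => y) 2 (P.map X) := by rwa [hX.map_eq]
  exact (memLp_map_measure_iff (by fun_prop) hX.aemeasurable).1 this

/-- Chebyshev's inequality for a weighted sum of i.i.d. variables with weights bounded by one. -/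
theorem measureReal_weighted_sum_le [IsProbabilityMeasure P] {N : ℕ} {X : Fin N → Ω → ℝ}
    (hlaw : ∀ k, HasLaw (X k) D P)
    (hindep : iIndepFun X P) (hD : MemLp (fun y => y) 2 D) (w : Fin N → ℝ) (hw : ∀ k, |w k| ≤ 1)
    {c : ℝ} (hc : 0 < c) :
    P.real {ω | c ≤ |∑ k, w k * (X k ω - ∫ y, y ∂D)|} ≤ N * variance (fun y => y) D / c ^ 2 := by
  have hmem : ∀ k, MemLp (X k) 2 P := fun k => memLp_of_hasLaw (hlaw k) hD
  have hmem' : ∀ k, MemLp (fun ω => w k * X k ω) 2 P := fun k => (hmem k).const_mul (w k)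
  set S : Ω → ℝ := ∑ k, fun ω => w k * X k ω with hS
  have hSmem : MemLp S 2 P := memLp_finsetSum' _ fun k _ => hmem' k
  have hSE : P[S] = ∑ k, w k * ∫ y, y ∂D := by
    have : S = fun ω => ∑ k, w k * X k ω := by ext ω; simp [hS]
    rw [this, integral_finsetSum _ fun k _ => (hmem' k).integrable one_le_two]
    refine Finset.sum_congr rfl fun k _ => ?_
    rw [integral_const_mul, (hlaw k).integral_eq]
  have hvar : variance S P ≤ N * variance (fun y => y) D := by
    rw [hS, IndepFun.variance_sum (fun k _ => hmem' k)]
    · calc ∑ k, variance (fun ω => w k * X k ω) P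
          ≤ ∑ _k : Fin N, variance (fun y => y) D := by
            refine Finset.sum_le_sum fun k _ => ?_
            rw [variance_const_mul, (hlaw k).variance_eq]
            refine mul_le_of_le_one_left (variance_nonneg _ _) ?_
            rw [← sq_abs]
            exact pow_le_one₀ (abs_nonneg _) (hw k)
        _ = N * variance (fun y => y) D := by simp
    · intro i _ j _ hij
      exact (hindep.indepFun hij).comp (measurable_const_mul (w i)) (measurable_const_mul (w j))
  have hset : {ω | c ≤ |∑ k, w k * (X k ω - ∫ y, y ∂D)|} = {ω | c ≤ |S ω - P[S]|} := by
    ext ω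
    rw [Set.mem_ofPred_eq, Set.mem_ofPred_eq, hSE, hS, Finset.sum_apply, ← Finset.sum_sub_distrib]
    simp only [mul_sub]
  rw [hset]
  refine (ENNReal.toReal_mono ENNReal.ofReal_ne_top
    (meas_ge_le_variance_div_sq hSmem hc)).trans ?_
  rw [ENNReal.toReal_ofReal (div_nonneg (variance_nonneg _ _) (sq_nonneg _))]
  gcongr

/-- Weak law of large numbers for weighted triangular arrays. -/
theorem tendsto_measureReal_weighted_sum [IsProbabilityMeasure P] {X : (N : ℕ) → Fin N → Ω → ℝ}
    (hlaw : ∀ N k, HasLaw (X N k) D P) (hindep : ∀ N, iIndepFun (X N) P)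
    (hD : MemLp (fun y => y) 2 D) (w : (N : ℕ) → Fin N → ℝ) (hw : ∀ N k, |w N k| ≤ 1)
    {c : ℝ} (hc : 0 < c) :
    Tendsto (fun N : ℕ => P.real {ω | c * N ≤ |∑ k, w N k * (X N k ω - ∫ y, y ∂D)|}) atTop
      (𝓝 0) := by
  have hlim : Tendsto (fun N : ℕ => variance (fun y => y) D / c ^ 2 / (N : ℝ)) atTop (𝓝 0) :=
    tendsto_const_div_atTop_nhds_zero_nat _
  refine tendsto_of_tendsto_of_tendsto_of_le_of_le' tendsto_const_nhds hlim
    (Eventually.of_forall fun N => measureReal_nonneg) ?_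
  filter_upwards [eventually_gt_atTop 0] with N hN
  have hN' : (0 : ℝ) < N := by exact_mod_cast hN
  refine (measureReal_weighted_sum_le (hlaw N) (hindep N) hD (w N) (hw N)
    (mul_pos hc hN')).trans (le_of_eq ?_)
  field_simp

/-- The maximum of `N` variables with finite second moment is `o(N ^ a)` for `a > 1 / 2`. -/
theorem tendsto_measureReal_exists_gt [IsFiniteMeasure D] {X : (N : ℕ) → Fin N → Ω → ℝ}
    (hlaw : ∀ N k, HasLaw (X N k) D P) (hD : MemLp (fun y => y) 2 D) {a : ℝ} (ha : 1 / 2 < a) :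
    Tendsto (fun N : ℕ => P.real {ω | ∃ k, (N : ℝ) ^ a < X N k ω}) atTop (𝓝 0) := by
  have hlim : Tendsto (fun N : ℕ => (∫ y, y ^ 2 ∂D) * (N : ℝ) ^ (-(2 * a - 1))) atTop (𝓝 0) := by
    have := ((tendsto_rpow_neg_atTop (by linarith : 0 < 2 * a - 1)).comp
      tendsto_natCast_atTop_atTop).const_mul (∫ y, y ^ 2 ∂D)
    rwa [mul_zero] at this
  refine tendsto_of_tendsto_of_tendsto_of_le_of_le' tendsto_const_nhds hlim
    (Eventually.of_forall fun N => measureReal_nonneg) ?_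
  filter_upwards [eventually_gt_atTop 0] with N hN
  have hN' : (0 : ℝ) < N := by exact_mod_cast hN
  have hpow : (0 : ℝ) < (N : ℝ) ^ a := Real.rpow_pos_of_pos hN' a
  -- Markov's inequality for the square; the union over `N` indices then gives `N ^ (1 - 2 a)`,
  -- whence the threshold `1 / 2`.
  have h1 : ∀ k : Fin N,
      P.real {ω | (N : ℝ) ^ a < X N k ω} ≤ (∫ y, y ^ 2 ∂D) / ((N : ℝ) ^ a) ^ 2 := by
    intro k
    rw [(hlaw N k).measureReal_eq (p := fun y => (N : ℝ) ^ a < y) measurableSet_Ioi,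
      le_div_iff₀ (by positivity), mul_comm]
    refine le_trans (mul_le_mul_of_nonneg_left (measureReal_mono fun y hy => ?_) (by positivity))
      (mul_meas_ge_le_integral_of_nonneg (Eventually.of_forall fun y => sq_nonneg y)
        hD.integrable_sq (((N : ℝ) ^ a) ^ 2))
    exact pow_le_pow_left₀ hpow.le (le_of_lt hy) 2
  have h2 : {ω | ∃ k, (N : ℝ) ^ a < X N k ω} = ⋃ k, {ω | (N : ℝ) ^ a < X N k ω} := by
    ext ω; simp
  rw [h2]
  refine (measureReal_iUnion_fintype_le _).trans ((Finset.sum_le_sum fun k _ => h1 k).trans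
    (le_of_eq ?_))
  rw [Finset.sum_const, Finset.card_univ, Fintype.card_fin, nsmul_eq_mul,
    show -(2 * a - 1) = 1 - a * (2 : ℕ) by push_cast; ring, Real.rpow_sub hN', Real.rpow_one,
    Real.rpow_mul_natCast hN'.le]
  ring

end

/-! ### Assembling the deterministic and probabilistic estimates. -/

/-- The deterministic half of the limit. The three error terms come from the interaction of the
solitons, the fluctuation of the amplitudes about `m`, and the Riemann sum; `hone` keeps the total
amplitude below `N (m + 1)`. -/
theorem norm_scaled_syncSoliton_sub_fresnel_le {N : ℕ} {Δ m B X T ε η : ℝ} {a : Fin N → ℝ}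
    (hN : N ≠ 0) (hΔ : 0 < Δ) (hm : 0 < m) (ha0 : ∀ k, 0 < a k) (haB : ∀ k, a k ≤ B)
    (hεdef : ε = 8 * B * (1 + Real.log N) / Δ) (hε0 : 0 ≤ ε) (hε : ε ≤ 1 / 14)
    (hεXT : (|X| + |T|) * ε ≤ 1)
    (hre : |∑ k : Fin N, (wave X T ((((k : ℕ) : ℝ) + 1) / N)).re * (a k - m)| < η * N)
    (him : |∑ k : Fin N, (wave X T ((((k : ℕ) : ℝ) + 1) / N)).im * (a k - m)| < η * N)
    (hone : |∑ k, 1 * (a k - m)| < 1 * N) :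
    ‖1 / ((m : ℂ) * (N : ℂ)) *
        syncSoliton Δ a (2 * X / (Δ * N)) (1 + T / (Δ ^ 2 * (N : ℝ) ^ 2)) - fresnel X T‖ ≤
      (12 + 10 * (|X| + |T|)) * ε * ((m + 1) / m) + 2 * η / m +
        ‖1 / (N : ℂ) * ∑ k : Fin N, wave X T ((((k : ℕ) : ℝ) + 1) / N) -
          ∫ s in (0 : ℝ)..1, wave X T s‖ := by
  have hNpos : (0 : ℝ) < N := by exact_mod_cast Nat.pos_of_ne_zero hN
  have hN' : (N : ℂ) ≠ 0 := Nat.cast_ne_zero.2 hN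
  have hm' : (m : ℂ) ≠ 0 := ofReal_ne_zero.2 hm.ne'
  set ψ := syncSoliton Δ a (2 * X / (Δ * N)) (1 + T / (Δ ^ 2 * (N : ℝ) ^ 2))
  set u : Fin N → ℂ := fun k => wave X T ((((k : ℕ) : ℝ) + 1) / N)
  have hsum : ∑ k, a k ≤ N * (m + 1) := by
    have h := (abs_lt.1 hone).2
    simp only [one_mul, Finset.sum_sub_distrib, Finset.sum_const, Finset.card_univ,
      Fintype.card_fin, nsmul_eq_mul] at h
    linarith
  have h1 : ‖ψ + ∑ k, (a k : ℂ) * u k‖ ≤ (12 + 10 * (|X| + |T|)) * ε * (N * (m + 1)) :=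
    (norm_syncSoliton_add_le hN hΔ ha0 haB hεdef hε hεXT).trans
      (mul_le_mul_of_nonneg_left hsum (by positivity))
  have h2 : ‖∑ k, u k * ((a k - m : ℝ) : ℂ)‖ ≤ 2 * η * N := by
    refine (norm_le_abs_re_add_abs_im _).trans ?_
    simp only [re_sum, im_sum, re_mul_ofReal, im_mul_ofReal]
    linarith
  have hdecomp : 1 / ((m : ℂ) * (N : ℂ)) * ψ - fresnel X T =
      1 / ((m : ℂ) * (N : ℂ)) * (ψ + ∑ k, (a k : ℂ) * u k) -
        1 / ((m : ℂ) * (N : ℂ)) * (∑ k, u k * ((a k - m : ℝ) : ℂ)) -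
        (1 / (N : ℂ) * ∑ k, u k - ∫ s in (0 : ℝ)..1, wave X T s) := by
    have e1 : ∑ k, u k * ((a k - m : ℝ) : ℂ) = ∑ k, (a k : ℂ) * u k - m * ∑ k, u k := by
      rw [Finset.mul_sum, ← Finset.sum_sub_distrib]
      exact Finset.sum_congr rfl fun k _ => by push_cast; ring
    have e2 : fresnel X T = -∫ s in (0 : ℝ)..1, wave X T s := rfl
    rw [e1, e2]
    field_simp
    ring
  have hnorm : ‖1 / ((m : ℂ) * (N : ℂ))‖ = 1 / (m * N) := by
    rw [norm_div, norm_one, norm_mul, norm_real, Real.norm_of_nonneg hm.le, norm_natCast]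
  rw [hdecomp]
  refine (norm_sub_le _ _).trans (add_le_add ((norm_sub_le _ _).trans (add_le_add ?_ ?_)) le_rfl)
  · rw [norm_mul, hnorm]
    refine (mul_le_mul_of_nonneg_left h1 (by positivity)).trans (le_of_eq ?_)
    field_simp
  · rw [norm_mul, hnorm]
    refine (mul_le_mul_of_nonneg_left h2 (by positivity)).trans (le_of_eq ?_)
    field_simp

theorem tendstoInMeasure_syncSoliton {Ω : Type*} [MeasurableSpace Ω] {P : Measure Ω}
    [IsProbabilityMeasure P] {D : Measure ℝ} [IsProbabilityMeasure D] {β γ : ℝ}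
    (hβ : 0 < β) (hγ : 1 / 2 < γ) (hDpos : ∀ᵐ y ∂D, 0 < y) (hD : MemLp (fun y => y) 2 D)
    {μ : (N : ℕ) → Fin N → Ω → ℝ} (hlaw : ∀ N k, HasLaw (μ N k) D P)
    (hindep : ∀ N, iIndepFun (μ N) P) (X T : ℝ) :
    TendstoInMeasure P
      (fun (N : ℕ) (ω : Ω) =>
        1 / (((∫ y, y ∂D : ℝ) : ℂ) * (N : ℂ)) *
          syncSoliton (spacing β γ N) (fun k => μ N k ω)
            (2 * X / (spacing β γ N * N)) (1 + T / (spacing β γ N ^ 2 * (N : ℝ) ^ 2)))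
      atTop (fun _ => fresnel X T) := by
  have hint : Integrable (fun y => y) D := hD.integrable one_le_two
  set m := ∫ y, y ∂D with hmdef
  have hm : 0 < m := by
    rw [hmdef, integral_pos_iff_support_of_nonneg_ae (hDpos.mono fun y hy => hy.le) hint,
      pos_iff_ne_zero]
    intro h0
    obtain ⟨y, hy1, hy2⟩ := (hDpos.and (measure_eq_zero_iff_ae_notMem.1 h0)).exists
    exact hy2 hy1.ne'
  -- `b > 1 / 2` controls the maximal amplitude, `b < γ` keeps it negligible against the spacing.
  obtain ⟨b, hb1, hb2⟩ := exists_between hγ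
  rw [tendstoInMeasure_iff_measureReal_norm]
  intro δ hδ
  set C := |X| + |T| with hC
  have hC0 : 0 ≤ C := by positivity
  -- Chosen so that the fluctuation term `2 η / m` is `δ / 4`; the other two terms are also made
  -- less than `δ / 4`, for a total below `δ`.
  set η := m * δ / 8 with hη
  have hη0 : 0 < η := by positivity
  let u : (N : ℕ) → Fin N → ℂ := fun N k => wave X T ((((k : ℕ) : ℝ) + 1) / N)
  have hu : ∀ N k, ‖u N k‖ = 1 := fun N k => norm_wave _ _ _
  set A0 : ℕ → Set Ω := fun N => {ω | ∃ k, (N : ℝ) ^ b < μ N k ω}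
  set A1 : ℕ → Set Ω := fun N => {ω | η * N ≤ |∑ k, (u N k).re * (μ N k ω - m)|}
  set A2 : ℕ → Set Ω := fun N => {ω | η * N ≤ |∑ k, (u N k).im * (μ N k ω - m)|}
  set A3 : ℕ → Set Ω := fun N => {ω | 1 * N ≤ |∑ k, 1 * (μ N k ω - m)|}
  set A4 : ℕ → Set Ω := fun N => {ω | ¬ ∀ k, 0 < μ N k ω}
  have l0 : Tendsto (fun N => P.real (A0 N)) atTop (𝓝 0) :=
    tendsto_measureReal_exists_gt hlaw hD hb1
  have l1 : Tendsto (fun N => P.real (A1 N)) atTop (𝓝 0) :=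
    tendsto_measureReal_weighted_sum hlaw hindep hD (fun N k => (u N k).re)
      (fun N k => (abs_re_le_norm _).trans (hu N k).le) hη0
  have l2 : Tendsto (fun N => P.real (A2 N)) atTop (𝓝 0) :=
    tendsto_measureReal_weighted_sum hlaw hindep hD (fun N k => (u N k).im)
      (fun N k => (abs_im_le_norm _).trans (hu N k).le) hη0
  have l3 : Tendsto (fun N => P.real (A3 N)) atTop (𝓝 0) :=
    tendsto_measureReal_weighted_sum hlaw hindep hD (fun _ _ => 1) (by simp) one_pos
  have h4 : ∀ N, P.real (A4 N) = 0 := fun N => by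
    have : ∀ᵐ ω ∂P, ∀ k, 0 < μ N k ω := ae_all_iff.2 fun k =>
      ((hlaw N k).ae_iff (p := fun y => 0 < y) (by fun_prop)).2 hDpos
    rw [measureReal_def, ae_iff.1 this, ENNReal.toReal_zero]
  have hlim : Tendsto (fun N => P.real (A0 N) + P.real (A1 N) + P.real (A2 N) + P.real (A3 N))
      atTop (𝓝 0) := by
    simpa using ((l0.add l1).add l2).add l3
  have hε := tendsto_rpow_mul_log_div_spacing hβ.ne' hb2
  have hsmall : ∀ c : ℝ, ∀ r > 0, ∀ᶠ N : ℕ in atTop,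
      c * (8 * (N : ℝ) ^ b * (1 + Real.log N) / spacing β γ N) < r := fun c r hr => by
    have := hε.const_mul c
    rw [mul_zero] at this
    exact this.eventually_lt_const hr
  have hRie := (tendsto_iff_norm_sub_tendsto_zero.1
    (tendsto_riemannSum (continuous_wave X T))).eventually_lt_const (by positivity : 0 < δ / 4)
  refine tendsto_of_tendsto_of_tendsto_of_le_of_le' tendsto_const_nhds hlim
    (Eventually.of_forall fun N => measureReal_nonneg) ?_
  filter_upwards [eventually_gt_atTop 0, hsmall 1 (1 / 14) (by norm_num), hsmall C 1 one_pos,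
    hsmall ((12 + 10 * C) * ((m + 1) / m)) (δ / 4) (by positivity), hRie] with N hN e1 e2 e3 e4
  have hNpos : (0 : ℝ) < N := by exact_mod_cast hN
  have hN1 : (1 : ℝ) ≤ N := by exact_mod_cast hN
  have hΔ : 0 < spacing β γ N := mul_pos hβ (Real.rpow_pos_of_pos hNpos γ)
  have hsub : {ω | δ ≤ ‖1 / ((m : ℂ) * (N : ℂ)) *
      syncSoliton (spacing β γ N) (fun k => μ N k ω) (2 * X / (spacing β γ N * N))
        (1 + T / (spacing β γ N ^ 2 * (N : ℝ) ^ 2)) - fresnel X T‖} ⊆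
      A0 N ∪ A1 N ∪ A2 N ∪ A3 N ∪ A4 N := by
    intro ω hω
    by_contra hbad
    simp only [Set.mem_union, not_or] at hbad
    obtain ⟨⟨⟨⟨b0, b1⟩, b2⟩, b3⟩, b4⟩ := hbad
    have b0' : ∀ k, μ N k ω ≤ (N : ℝ) ^ b := fun k => not_lt.1 fun h => b0 ⟨k, h⟩
    have b4' : ∀ k, 0 < μ N k ω := not_not.1 b4
    have hε0 : 0 ≤ 8 * (N : ℝ) ^ b * (1 + Real.log N) / spacing β γ N := by
      have := Real.log_nonneg hN1
      positivity
    have key := norm_scaled_syncSoliton_sub_fresnel_le hN.ne' hΔ hm b4' b0' rfl hε0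
      (by linarith) e2.le (not_le.1 b1) (not_le.1 b2) (not_le.1 b3)
    have e5 : 2 * η / m = δ / 4 := by rw [hη]; field_simp; norm_num
    have hω' : δ ≤ _ := hω
    have := hω'.trans key
    rw [e5] at this
    linarith
  refine (measureReal_mono hsub).trans ?_
  have i1 := measureReal_union_le (μ := P) (A0 N ∪ A1 N ∪ A2 N ∪ A3 N) (A4 N)
  have i2 := measureReal_union_le (μ := P) (A0 N ∪ A1 N ∪ A2 N) (A3 N)
  have i3 := measureReal_union_le (μ := P) (A0 N ∪ A1 N) (A2 N)
  have i4 := measureReal_union_le (μ := P) (A0 N) (A1 N)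
  linarith [h4 N]

end FNLS

theorem proposition1p5 {Ω : Type*} [MeasurableSpace Ω] (P : Measure Ω) [IsProbabilityMeasure P]
    (D : Measure ℝ) [IsProbabilityMeasure D] (ν α β γ : ℝ)
    (hβ : 0 < β) (hγ : 1 / 2 < γ)
    (hDpos : ∀ᵐ y ∂D, 0 < y) (hDsub : FNLS.IsSubExponential D ν α)
    (μ : (N : ℕ) → Fin N → Ω → ℝ)
    (hlaw : ∀ (N : ℕ) (k : Fin N), HasLaw (μ N k) D P)
    (hindep : ∀ N : ℕ, iIndepFun (μ N) P) :
    (∀ X T : ℝ,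
      TendstoInMeasure P
        (fun (N : ℕ) (ω : Ω) =>
          1 / (((∫ y, y ∂D : ℝ) : ℂ) * (N : ℂ)) *
            FNLS.syncSoliton (FNLS.spacing β γ N) (fun k => μ N k ω)
              (2 * X / (FNLS.spacing β γ N * N))
              (1 + T / (FNLS.spacing β γ N ^ 2 * (N : ℝ) ^ 2)))
        atTop (fun _ => FNLS.fresnel X T)) ∧
    (∀ X : ℝ,
      TendstoInMeasure P
        (fun (N : ℕ) (ω : Ω) =>
          1 / (((∫ y, y ∂D : ℝ) : ℂ) * (N : ℂ)) *
            FNLS.syncSoliton (FNLS.spacing β γ N) (fun k => μ N k ω)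
              (2 * X / (FNLS.spacing β γ N * N)) 1)
        atTop (fun _ => -((Real.sinc X : ℝ) : ℂ) * Complex.exp (Complex.I * (X : ℂ)))) := by
  have main := FNLS.tendstoInMeasure_syncSoliton hβ hγ hDpos hDsub.memLp_two hlaw hindep
  refine ⟨main, fun X => ?_⟩
  have h := main X 0
  simp only [zero_div, add_zero, FNLS.fresnel_zero] at h
  exact h
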